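/- Let $P=\{x\in\mathbb R^n:\ {}^t\nu_r x\ge\lambda_r,\ r=1,\dots,d\}$ be a Delzant lattice polytope ($\nu_r\in\mathbb Z^n$ the inward facet normals, $\lambda_r\in\mathbb Z$), with interior $\breve P$, and put $\ell_r(x)={}^t\nu_r x-\lambda_r$. Let $(X_P,\omega)$ be the associated closed toric symplectic manifold of dimension $2n$, $\mu:X_P\to P$ its moment map, and $(x,\theta)\in\breve P\times(\mathbb R/2\pi\mathbb Z)^n$ the action-angle coordinates on $\mu^{-1}(\breve P)$, so that $x=\mu$ and $\omega=\sum_i dx_i\wedge d\theta_i$. Let $(L,\nabla,h)$ be the prequantum line bundle on $X_P$ given by the Delzant construction (curvature $-\sqrt{-1}\,\omega$), $\pi:S\to X_P$ its bundle of unit vectors, a principal $S^1$-bundle, and $\sqrt{-1}A$ the connection form on $S$ defined by $\nabla$; over $\mu^{-1}(\breve P)$ one has $A=dt-\sum_i x_i\,d\theta_i$. Put $v_P=\frac12\sum_{r=1}^d\ell_r\log\ell_r$. Let $\varphi\in C^\infty(P)$ be such that $\mathrm{Hess}(v_P+\varphi)$ is positive definite on $\breve P$ and $\det(\mathrm{Hess}(v_P+\varphi))\prod_r\ell_r$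 extends to a smooth positive function on $P$, and let $\psi\in C^\infty(P)$ have positive definite Hessian on $P$. For $s>0$ let $G_s=\mathrm{Hess}(v_P+\varphi+s^{-1}\psi)$, let $J_s$ be the complex structure with $J_s(\partial_{x_i})=\sum_j G_{s,ij}\,\partial_{\theta_j}$ and $J_s(\partial_{\theta_i})=-\sum_j (G_s^{-1})_{ij}\,\partial_{x_j}$, let $g_s=\omega(\cdot,J_s\cdot)$, and let $\hat g_s=A\otimes A+\pi^*g_s$ be the induced Riemannian metric on $S$, with volume measure $\nu_{\hat g_s}$. All $L^2$-norms at the parameter $s$ are those of $L^2(S,s^{-n/2}\nu_{\hat g_s})$, with pointwise norms of differentials taken with respect to $\hat g_s$. Let $k\ge1$ be an integer. Let $(C^\infty(S)\otimes\mathbb C)^{\rho_k}$ be the space of smooth $f:S\to\mathbb C$ with $\sigma^k f(u\sigma)=f(u)$ for all $u\in S$, $\sigma\in S^1$ (that is, of smooth sections of $L^k$). Let $B_k\subset P$ be the set of Bohr–Sommerfeld points of level $k$, i.e. of those $b\in P$ for which $L^k|_{\mu^{-1}(b)}$ has a non-zero flat section. For $r>0$ put $B(B_k,r)=\{x\in P:\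 \inf_{y\in B_k}\|x-y\|<r\}$. **Proposition.** Let $\delta>0$, and for each $0<s<\delta$ let $f_s\in(C^\infty(S)\otimes\mathbb C)^{\rho_k}$ be such that $\|f_s\|_{L^2}=1$ for all $0<s<\delta$ and $\sup_{0<s<\delta}\|df_s\|_{L^2}<\infty$. Then for every $\varepsilon>0$ there is $C>0$ such that for all $0<s<\delta$ $$\bigl\|\,f_s|_{(\mu\circ\pi)^{-1}(B(B_k,\sqrt s\,C))}\bigr\|_{L^2}^2\ \ge\ 1-\varepsilon .$$ -/

import Mathlib

open MeasureTheory
open scoped ContDiff Matrix ENNReal NNReal ComplexConjugate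

noncomputable section

namespace Toric

/-- The Euclidean space `ℝⁿ` in which the polytope lives. -/
abbrev Base (n : ℕ) := EuclideanSpace ℝ (Fin n)

/-- The affine function `ℓ(x) = ᵗν x - λ`. -/
def affineSlack {n : ℕ} (nu : Fin n → ℤ) (lam : ℤ) (x : Base n) : ℝ :=
  ∑ i, (nu i : ℝ) * x i - (lam : ℝ)

/-- The set `{x ∈ ℝⁿ ; ᵗν_r x ≥ λ_r, r = 1, …, d}`. -/
def polyhedron {n d : ℕ} (nu : Fin d → Fin n → ℤ) (lam : Fin d → ℤ) : Set (Base n) :=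
  {x | ∀ r, 0 ≤ affineSlack (nu r) (lam r) x}

/-- A Delzant lattice polytope in `ℝⁿ` with `d` facets, presented by its inward normals `ν_r ∈ ℤⁿ`
and its offsets `λ_r ∈ ℤ`: a bounded polyhedron with non-empty interior, each of whose inequalities
cuts out a facet, such that at each vertex the normals of the facets through this vertex form a
`ℤ`-basis of `ℤⁿ`.  (The vertices are then lattice points, as the `λ_r` are integers.) -/
structure DelzantPolytope (n d : ℕ) where
  /-- the inward normals `ν_r` of the facets -/
  normal : Fin d → Fin n → ℤ
  /-- the offsets `λ_r` of the facets -/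
  offset : Fin d → ℤ
  isBounded : Bornology.IsBounded (polyhedron normal offset)
  nonempty_interior : (interior (polyhedron normal offset)).Nonempty
  facet : ∀ r, ∃ x ∈ polyhedron normal offset,
    ∀ q, affineSlack (normal q) (offset q) x = 0 ↔ q = r
  linearIndependent_at_vertex : ∀ v ∈ (polyhedron normal offset).extremePoints ℝ,
    LinearIndependent ℤ
      (fun r : {r : Fin d // affineSlack (normal r) (offset r) v = 0} => normal r)
  span_at_vertex : ∀ v ∈ (polyhedron normal offset).extremePoints ℝ,
    Submodule.span ℤ
      (Set.range (fun r : {r : Fin d // affineSlack (normal r) (offset r) v = 0} => normal r)) = ⊤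

/-- The Hessian matrix at `x` of a function `u` on the set `D` (a full-dimensional polytope below,
so that the second derivatives within `D` are well defined up to the boundary). -/
def hessian {n : ℕ} (D : Set (Base n)) (u : Base n → ℝ) (x : Base n) :
    Matrix (Fin n) (Fin n) ℝ :=
  Matrix.of fun i j =>
    iteratedFDerivWithin ℝ 2 u D x ![EuclideanSpace.single i 1, EuclideanSpace.single j 1]

/-- Coordinate vectors `(x, θ, t)`; also tangent vectors in these coordinates. -/
abbrev Coord (n : ℕ) := Base n × (Fin n → ℝ) × ℝ

/-- Indices of the coordinates `x_i`, `θ_i`, `t`. -/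
abbrev CoordIdx (n : ℕ) := Fin n ⊕ Fin n ⊕ Unit

/-- The coordinate vector fields `∂/∂x_i`, `∂/∂θ_i`, `∂/∂t`. -/
def coordVec {n : ℕ} : CoordIdx n → Coord n
  | Sum.inl i => (EuclideanSpace.single i 1, 0, 0)
  | Sum.inr (Sum.inl i) => (0, Pi.single i 1, 0)
  | Sum.inr (Sum.inr _) => (0, 0, 1)

/-- The symplectic form `ω = ∑ dx_i ∧ dθ_i`, on tangent vectors in the coordinates `(x, θ)`. -/
def omega {n : ℕ} (v w : (Fin n → ℝ) × (Fin n → ℝ)) : ℝ :=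
  v.1 ⬝ᵥ w.2 - v.2 ⬝ᵥ w.1

/-- The complex structure with
`J(∂/∂x_i) = ∑_j G_ij ∂/∂θ_j` and `J(∂/∂θ_i) = - ∑_j (G⁻¹)_ij ∂/∂x_j`. -/
def complexStr {n : ℕ} (G : Matrix (Fin n) (Fin n) ℝ) (v : (Fin n → ℝ) × (Fin n → ℝ)) :
    (Fin n → ℝ) × (Fin n → ℝ) :=
  (-(v.2 ᵥ* G⁻¹), v.1 ᵥ* G)

/-- The Riemannian metric `g_J = ω(·, J ·)`. -/
def kahlerMetric {n : ℕ} (G : Matrix (Fin n) (Fin n) ℝ) (v w : (Fin n → ℝ) × (Fin n → ℝ)) : ℝ :=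
  omega v (complexStr G w)

/-- The connection form `A = dt - ∑ x_i dθ_i` at the point with moment coordinate `x`. -/
def connForm {n : ℕ} (x : Base n) (v : Coord n) : ℝ := v.2.2 - ∑ i, x i * v.2.1 i

/-- The projection of a tangent vector of the circle bundle to the base, in coordinates. -/
def projVec {n : ℕ} (v : Coord n) : (Fin n → ℝ) × (Fin n → ℝ) := (fun i => v.1 i, v.2.1)

/-- The Riemannian metric `ĝ = A ⊗ A + (dπ|_H)^* g_J` of the circle bundle, in coordinates. -/
def bundleMetric {n : ℕ} (G : Matrix (Fin n) (Fin n) ℝ) (x : Base n) (v w : Coord n) : ℝ :=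
  connForm x v * connForm x w + kahlerMetric G (projVec v) (projVec w)

/-- The Gram matrix of `ĝ` in the coordinates `(x, θ, t)`. -/
def bundleGram {n : ℕ} (G : Matrix (Fin n) (Fin n) ℝ) (x : Base n) :
    Matrix (CoordIdx n) (CoordIdx n) ℝ :=
  Matrix.of fun a b => bundleMetric G x (coordVec a) (coordVec b)

namespace DelzantPolytope

variable {n d : ℕ} (P : DelzantPolytope n d)

/-- The polytope as a subset of `ℝⁿ`. -/
def carrier : Set (Base n) := polyhedron P.normal P.offset

/-- `ℓ_r(x) = ᵗν_r x - λ_r`. -/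
def slack (r : Fin d) (x : Base n) : ℝ := affineSlack (P.normal r) (P.offset r) x

/-! ### Symplectic potentials -/

/-- The standard symplectic potential `v_P = ½ ∑_r ℓ_r log ℓ_r`. -/
def vP (x : Base n) : ℝ := (1 / 2) * ∑ r, P.slack r x * Real.log (P.slack r x)

/-- The class `C^∞_{v_P}(P)`: smooth functions `φ` on `P` such that `Hess (v_P + φ)` is positive
definite on the interior of `P` and `det (Hess (v_P + φ)) ∏_r ℓ_r` extends from the interior to a
smooth positive function on `P`. -/
def IsAdmissible (φ : Base n → ℝ) : Prop :=
  ContDiffOn ℝ ∞ φ P.carrier ∧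
  (∀ x ∈ interior P.carrier, (hessian P.carrier (fun y => P.vP y + φ y) x).PosDef) ∧
  ∃ h : Base n → ℝ, ContDiffOn ℝ ∞ h P.carrier ∧ (∀ x ∈ P.carrier, 0 < h x) ∧
    ∀ x ∈ interior P.carrier,
      h x = (hessian P.carrier (fun y => P.vP y + φ y) x).det * ∏ r, P.slack r x

/-- The class `C^∞_+(P)`: smooth functions on `P` with positive definite Hessian on `P`. -/
def IsStrictlyConvex (ψ : Base n → ℝ) : Prop :=
  ContDiffOn ℝ ∞ ψ P.carrier ∧ ∀ x ∈ P.carrier, (hessian P.carrier ψ x).PosDef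

/-- `G_s = Hess (v_P + φ + s⁻¹ ψ)`. -/
def potentialHessian (φ ψ : Base n → ℝ) (s : ℝ) (x : Base n) : Matrix (Fin n) (Fin n) ℝ :=
  hessian P.carrier (fun y => P.vP y + φ y + s⁻¹ * ψ y) x

/-! ### The toric manifold and its prequantum circle bundle (Delzant construction) -/

/-- The level set `{(x, z) ∈ ℝⁿ × ℂᵈ ; ½ |z_r|² = ℓ_r(x) for all r}` of the Delzant construction.
As the `ℓ_r(x)` determine `x`, the second projection identifies it with the usual level set in
`ℂᵈ`; the condition forces `x ∈ P`. -/
def levelSet : Set (Base n × (Fin d → ℂ)) := {p | ∀ r, ‖p.2 r‖ ^ 2 = 2 * P.slack r p.1}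

/-- The kernel `K` of the homomorphism `𝕋ᵈ → 𝕋ⁿ` given by the normals `ν_1, …, ν_d`. -/
def kernelTorus : Subgroup (Fin d → Circle) where
  carrier := {κ | ∀ i, ∏ r, κ r ^ P.normal r i = 1}
  mul_mem' := by
    intro a b ha hb i
    simp [mul_zpow, Finset.prod_mul_distrib, ha i, hb i]
  one_mem' := by
    intro i
    simp
  inv_mem' := by
    intro a ha i
    simp [Finset.prod_inv_distrib, ha i]

/-- The character `κ ↦ ∏_r κ_r ^ (-λ_r)` by which `K` acts on the trivial line bundle. -/
def weight : (Fin d → Circle) →* Circle where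
  toFun κ := ∏ r, κ r ^ (-P.offset r)
  map_one' := by simp
  map_mul' a b := by simp only [Pi.mul_apply, mul_zpow, Finset.prod_mul_distrib]

/-- The orbit relation of `K` on the level set. -/
def levelSetoid : Setoid P.levelSet where
  r p q := ∃ κ ∈ P.kernelTorus, q.1.1 = p.1.1 ∧ ∀ r, q.1.2 r = (κ r : ℂ) * p.1.2 r
  iseqv :=
    { refl := fun p => ⟨1, P.kernelTorus.one_mem, rfl, by simp⟩
      symm := by
        rintro p q ⟨κ, hκ, hx, hz⟩
        exact ⟨κ⁻¹, P.kernelTorus.inv_mem hκ, hx.symm, fun r => by simp [hz r]⟩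
      trans := by
        rintro p q w ⟨κ, hκ, hx, hz⟩ ⟨κ', hκ', hx', hz'⟩
        exact ⟨κ' * κ, P.kernelTorus.mul_mem hκ' hκ, hx'.trans hx,
          fun r => by simp [hz r, hz' r, mul_assoc]⟩ }

/-- The orbit relation of `K` on (level set) `× S¹`, where `K` acts on `S¹` by the character
`weight`. -/
def bundleSetoid : Setoid (P.levelSet × Circle) where
  r p q := ∃ κ ∈ P.kernelTorus,
    q.1.1.1 = p.1.1.1 ∧ (∀ r, q.1.1.2 r = (κ r : ℂ) * p.1.1.2 r) ∧ q.2 = P.weight κ * p.2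
  iseqv :=
    { refl := fun p => ⟨1, P.kernelTorus.one_mem, rfl, by simp, by simp⟩
      symm := by
        rintro p q ⟨κ, hκ, hx, hz, hσ⟩
        exact ⟨κ⁻¹, P.kernelTorus.inv_mem hκ, hx.symm, fun r => by simp [hz r], by simp [hσ]⟩
      trans := by
        rintro p q w ⟨κ, hκ, hx, hz, hσ⟩ ⟨κ', hκ', hx', hz', hσ'⟩
        exact ⟨κ' * κ, P.kernelTorus.mul_mem hκ' hκ, hx'.trans hx,
          fun r => by simp [hz r, hz' r, mul_assoc], by rw [hσ', hσ, map_mul, mul_assoc]⟩ }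

/-- The toric manifold `X_P`. -/
def Manifold : Type := Quotient P.levelSetoid

/-- The circle bundle `S = S(L, h)` of unit vectors of the prequantum line bundle `L → X_P`
(so that `L = S ×_{S¹} ℂ`). -/
def CircleBundle : Type := Quotient P.bundleSetoid

instance : TopologicalSpace P.CircleBundle :=
  inferInstanceAs (TopologicalSpace (Quotient P.bundleSetoid))

instance : MeasurableSpace P.CircleBundle := borel _

instance : BorelSpace P.CircleBundle := ⟨rfl⟩

/-- The quotient map from (level set) `× S¹` onto `S`. -/
def toBundle (p : P.levelSet × Circle) : P.CircleBundle := Quotient.mk P.bundleSetoid p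

/-- The bundle projection `π : S → X_P`. -/
def proj : P.CircleBundle → P.Manifold :=
  Quotient.map (sa := P.bundleSetoid) (sb := P.levelSetoid) Prod.fst (by
    rintro p q ⟨κ, hκ, hx, hz, -⟩
    exact ⟨κ, hκ, hx, hz⟩)

/-- The moment map `μ_P : X_P → ℝⁿ`. -/
def moment : P.Manifold → Base n :=
  Quotient.lift (s := P.levelSetoid) (fun p => p.1.1) (by
    rintro p q ⟨κ, hκ, hx, hz⟩
    exact hx.symm)

/-- The principal right action `u ↦ u σ` of `σ ∈ S¹` on `S`. -/
def rotate (σ : Circle) : P.CircleBundle → P.CircleBundle :=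
  Quotient.map (sa := P.bundleSetoid) (sb := P.bundleSetoid) (fun p => (p.1, p.2 * σ)) (by
    rintro p q ⟨κ, hκ, hx, hz, hσ⟩
    exact ⟨κ, hκ, hx, hz, by simp [hσ, mul_assoc]⟩)

/-- The inclusion of (level set) `× S¹` into the vector space `ℝⁿ × ℂᵈ × ℂ`. -/
def ambient (p : P.levelSet × Circle) : Base n × (Fin d → ℂ) × ℂ := (p.1.1.1, p.1.1.2, (p.2 : ℂ))

/-- Smoothness of a complex function on `S`.  Since (level set) `× S¹` is a closed submanifold of
`ℝⁿ × ℂᵈ × ℂ` on which `K` acts freely with quotient `S`, a function on `S` is smooth iff its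
pull-back to (level set) `× S¹` is the restriction of a smooth function on `ℝⁿ × ℂᵈ × ℂ`. -/
def IsSmooth (f : P.CircleBundle → ℂ) : Prop :=
  ∃ F : Base n × (Fin d → ℂ) × ℂ → ℂ, ContDiff ℝ ∞ F ∧ ∀ p, f (P.toBundle p) = F (P.ambient p)

/-- The space `(C^∞(S) ⊗ ℂ)^{ρ_k}`, i.e. the smooth sections of `L^k`: smooth `f : S → ℂ` with
`σ^k f(uσ) = f(u)`. -/
def equivariantSmooth (k : ℕ) : Set (P.CircleBundle → ℂ) :=
  {f | P.IsSmooth f ∧ ∀ u, ∀ σ : Circle, (σ : ℂ) ^ k * f (P.rotate σ u) = f u}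

/-! ### Bohr-Sommerfeld points -/

/-- A smooth curve `c = (x, z, σ)` in (level set) `× S¹` is horizontal if it is annihilated by
`-i σ⁻¹ dσ - ½ ∑_r Im (z̄_r dz_r)`.  This form (namely `dt - ∑_r ½ |z_r|² dφ_r` for `σ = e^{it}`,
`z_r = |z_r| e^{iφ_r}`) descends to the connection form `A` of the prequantum bundle on `S`. -/
def IsHorizontalCurve (c : ℝ → P.levelSet × Circle) : Prop :=
  ContDiff ℝ ∞ (fun τ => P.ambient (c τ)) ∧
  ∀ τ, (conj ((c τ).2 : ℂ) * deriv (fun τ' => ((c τ').2 : ℂ)) τ).im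
    - (1 / 2) * ∑ r, (conj ((c τ).1.1.2 r) * deriv (fun τ' => (c τ').1.1.2 r) τ).im = 0

/-- `b ∈ P` is a Bohr-Sommerfeld point of level `k`: the restriction of `L^k` to `μ⁻¹(b)` has a
non-zero flat section, i.e. there is a non-zero `ρ_k`-equivariant function on `S|_{μ⁻¹(b)}` which is
constant along the horizontal curves in `S|_{μ⁻¹(b)}`.  (The values of `f` off `S|_{μ⁻¹(b)}` play
no role.) -/
def IsBohrSommerfeld (k : ℕ) (b : Base n) : Prop :=
  b ∈ P.carrier ∧ ∃ f : P.CircleBundle → ℂ,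
    (∀ u, P.moment (P.proj u) = b → ∀ σ : Circle, (σ : ℂ) ^ k * f (P.rotate σ u) = f u) ∧
    (∃ u, P.moment (P.proj u) = b ∧ f u ≠ 0) ∧
    ∀ c, P.IsHorizontalCurve c → (∀ τ, P.moment (P.proj (P.toBundle (c τ))) = b) →
      ∀ τ τ', f (P.toBundle (c τ)) = f (P.toBundle (c τ'))

/-- The set `B_k ⊆ P` of Bohr-Sommerfeld points of level `k`. -/
def bohrSommerfeld (k : ℕ) : Set (Base n) := {b | P.IsBohrSommerfeld k b}

/-- The neighbourhood `B(B_k, r) = {x ∈ P ; inf_{y ∈ B_k} ‖x - y‖ < r}`. -/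
def bsNeighbourhood (k : ℕ) (r : ℝ) : Set (Base n) :=
  P.carrier ∩ Metric.thickening r (P.bohrSommerfeld k)

/-! ### Action-angle coordinates on the part of `S` over the interior of `P` -/

/-- The range `P̊ × ℝⁿ × ℝ` of the coordinates `(x, θ, t)`, where `θ` and `t` are `2π`-periodic. -/
def coordDomain : Set (Coord n) := {q | q.1 ∈ interior P.carrier}

/-- The fundamental domain `P̊ × [0, 2π)ⁿ × [0, 2π)` of the coordinates. -/
def fundamentalDomain : Set (Coord n) :=
  {q | q.1 ∈ interior P.carrier ∧ (∀ i, q.2.1 i ∈ Set.Ico 0 (2 * Real.pi)) ∧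
    q.2.2 ∈ Set.Ico 0 (2 * Real.pi)}

/-- The `n × d` matrix whose columns are the normals `ν_r`. -/
def normalMatrix : Matrix (Fin n) (Fin d) ℝ := Matrix.of fun i r => (P.normal r i : ℝ)

/-- Angles `φ ∈ ℝᵈ` with `∑_r φ_r ν_r = θ`. -/
def angleLift (θ : Fin n → ℝ) : Fin d → ℝ :=
  P.normalMatrixᵀ *ᵥ ((P.normalMatrix * P.normalMatrixᵀ)⁻¹ *ᵥ θ)

/-- The point `(x, z, σ)` of (level set) `× S¹` with `z_r = √(2 ℓ_r(x)) e^{iφ_r}` and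
`σ = e^{i(t - ∑_r λ_r φ_r)}`, where `∑_r φ_r ν_r = θ`.  Its class in `S` does not depend on the
choice of such a `φ`. -/
def chartLift (q : P.coordDomain) : P.levelSet × Circle :=
  (⟨(q.1.1, fun r => ((√(2 * P.slack r q.1.1) : ℝ) : ℂ) * Circle.exp (P.angleLift q.1.2.1 r)),
    by
      intro r
      have h : 0 ≤ P.slack r q.1.1 := interior_subset (s := P.carrier) q.2 r
      simp [mul_pow, h]⟩,
    Circle.exp (q.1.2.2 - ∑ r, (P.offset r : ℝ) * P.angleLift q.1.2.1 r))

/-- The action-angle coordinates `(x, θ, t)` of `S` over the interior of `P`.  In them, the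
connection form is `dt - ∑ x_i dθ_i` and the symplectic form is `∑ dx_i ∧ dθ_i`. -/
def chart (q : P.coordDomain) : P.CircleBundle := P.toBundle (P.chartLift q)

/-- A function on `S` in action-angle coordinates (extended by `0` outside `P̊ × ℝⁿ × ℝ`). -/
def inCoord (f : P.CircleBundle → ℂ) : Coord n → ℂ :=
  Function.extend (Subtype.val : P.coordDomain → Coord n) (fun q => f (P.chart q)) 0

/-! ### Volume, `L²`-norm and energy -/

/-- The volume measure `√(det ĝ_s) dx dθ dt` in action-angle coordinates. -/
def coordVolume (φ ψ : Base n → ℝ) (s : ℝ) : Measure (Coord n) :=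
  (volume.restrict P.fundamentalDomain).withDensity fun q =>
    ENNReal.ofReal √(bundleGram (P.potentialHessian φ ψ s q.1) q.1).det

/-- The Riemannian volume measure `ν_{ĝ_s}` on `S` (the part of `S` over the boundary of `P` is a
union of submanifolds of positive codimension, hence a null set). -/
def bundleVolume (φ ψ : Base n → ℝ) (s : ℝ) : Measure P.CircleBundle :=
  Measure.map P.chart (Measure.comap Subtype.val (P.coordVolume φ ψ s))

/-- `‖f|_A‖²` in `L²(S, s^{-n/2} ν_{ĝ_s})`. -/
def massOn (φ ψ : Base n → ℝ) (s : ℝ) (f : P.CircleBundle → ℂ) (A : Set P.CircleBundle) : ℝ≥0∞ :=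
  ∫⁻ u in A, ‖f u‖ₑ ^ 2 ∂(ENNReal.ofReal (s ^ (-(n : ℝ) / 2)) • P.bundleVolume φ ψ s)

/-- The pointwise norm `|df|²_{ĝ_s} = ∑_{a,b} ĝ_s^{ab} ∂_a f (∂_b f)‾` at the point with
coordinates `q`. -/
def gradSq (φ ψ : Base n → ℝ) (s : ℝ) (f : P.CircleBundle → ℂ) (q : Coord n) : ℝ :=
  (∑ a, ∑ b, (((bundleGram (P.potentialHessian φ ψ s q.1) q.1)⁻¹ a b : ℝ) : ℂ) *
    (fderiv ℝ (P.inCoord f) q (coordVec a) * conj (fderiv ℝ (P.inCoord f) q (coordVec b)))).re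

/-- `‖df‖²` in `L²(S, s^{-n/2} ν_{ĝ_s})`. -/
def energy (φ ψ : Base n → ℝ) (s : ℝ) (f : P.CircleBundle → ℂ) : ℝ≥0∞ :=
  ENNReal.ofReal (s ^ (-(n : ℝ) / 2)) *
    ∫⁻ q, ENNReal.ofReal (P.gradSq φ ψ s f q) ∂(P.coordVolume φ ψ s)

end DelzantPolytope

end Toric

end

noncomputable section
namespace Toric

/-! ### A Poincaré inequality for the operator `d/dx - i a` on the circle -/

/-! The proof is a fibrewise spectral gap followed by a Chebyshev estimate. In the coordinates `(x,
θ, t)` the Gram determinant of the bundle metric is 1, so the volume is Lebesgue measure for every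
`s`. Completing the square in the dual metric shows that `|df|²` dominates the quadratic form `G_s`
evaluated on the horizontal derivatives `∂_{θ_i} f + x_i ∂_t f` (`le_re_sum_inv_bundleGram`).
Moreover `G_s ≥ c / s`, because `Hess ψ` is bounded below on the compact polytope
(`exists_le_potentialHessian`).

Equivariance gives `∂_t f = -i k f`, so on the torus over `x` the horizontal derivative is `∂_{θ_i}
- i k x_i`. On the `m`-th Fourier mode in `θ_i` it acts as `i (m - k x_i)`. Parseval therefore
bounds the fibre energy below by `∑ dist(k x_i, ℤ)²` times the fibre mass
(`ofReal_mul_lintegral_fibre_le`).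

This sum dominates a multiple of the squared distance from `x` to `B_k` (`exists_infDist_sq_le`).
Only the inclusion `P ∩ k⁻¹ℤⁿ ⊆ B_k` is needed, and it is witnessed by monomial sections
(`mem_bohrSommerfeld`). Outside the `√s C`-neighbourhood the factor `c / s` cancels the `s` in the
squared distance, so the mass there is `O(1 / C²)` uniformly in `s`. -/

theorem fourierCoeffOn_sub_mul_self {u u' : ℝ → ℂ} (hu : ∀ x, HasDerivAt u (u' x) x)
    (hu' : Continuous u') (hper : u (2 * Real.pi) = u 0) (a : ℝ) (m : ℤ) :
    fourierCoeffOn Real.two_pi_pos (fun x => u' x - Complex.I * a * u x) m =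
      Complex.I * ((m : ℂ) - a) * fourierCoeffOn Real.two_pi_pos u m := by
  have huc : Continuous u := continuous_iff_continuousAt.2 fun x => (hu x).continuousAt
  -- The period is written `2 * π - 0` to match the circle used by `fourierCoeffOn` on `[0, 2π]`.
  set e : ℝ → ℂ := fun x => fourier (-m) (x : AddCircle (2 * Real.pi - 0)) with he
  have hde : ∀ x, HasDerivAt e (-(Complex.I * m) * e x) x := by
    intro x
    convert hasDerivAt_fourier_neg (2 * Real.pi - 0) m x using 1
    have : (Real.pi : ℂ) ≠ 0 := by exact_mod_cast Real.pi_ne_zero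
    simp only [he]
    push_cast
    field_simp
    ring
  have hec : Continuous e := continuous_iff_continuousAt.2 fun x => (hde x).continuousAt
  -- Integration by parts: the boundary terms cancel because both `e` and `u` take equal values at
  -- the endpoints.
  have hftc : ∫ x in (0 : ℝ)..(2 * Real.pi),
      (-(Complex.I * m) * e x * u x + e x * u' x) = 0 := by
    rw [intervalIntegral.integral_eq_sub_of_hasDerivAt (f := fun x => e x * u x)
      (fun x _ => (hde x).mul (hu x))]
    · have : e (2 * Real.pi) = e 0 := by
        have h := AddCircle.coe_add_period (2 * Real.pi - 0) 0
        simp only [he]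
        rw [← h]
        simp
      rw [this, hper, sub_self]
    · exact (((continuous_const.mul hec).mul huc).add (hec.mul hu')).intervalIntegrable _ _
  rw [fourierCoeffOn_eq_integral, fourierCoeffOn_eq_integral, mul_smul_comm]
  congr 1
  change ∫ x in (0 : ℝ)..(2 * Real.pi), e x • (u' x - Complex.I * a * u x) =
    Complex.I * ((m : ℂ) - a) * ∫ x in (0 : ℝ)..(2 * Real.pi), e x • u x
  rw [← intervalIntegral.integral_const_mul, ← sub_eq_zero,
    ← intervalIntegral.integral_sub, ← hftc]
  · congr 1
    ext x
    simp only [smul_eq_mul]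
    ring
  · exact (Continuous.smul hec (hu'.sub (continuous_const.mul huc))).intervalIntegrable _ _
  · exact (continuous_const.mul (Continuous.smul hec huc)).intervalIntegrable _ _

/-- Parseval on both sides reduces the inequality to one between Fourier coefficients, where the
operator multiplies by `i (m - a)`. -/
theorem mul_integral_norm_sq_le {u u' : ℝ → ℂ} (hu : ∀ x, HasDerivAt u (u' x) x)
    (hu' : Continuous u') (hper : u (2 * Real.pi) = u 0) {a D : ℝ}
    (hD : ∀ m : ℤ, D ≤ ((m : ℝ) - a) ^ 2) :
    D * ∫ x in (0 : ℝ)..(2 * Real.pi), ‖u x‖ ^ 2 ≤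
      ∫ x in (0 : ℝ)..(2 * Real.pi), ‖u' x - Complex.I * a * u x‖ ^ 2 := by
  have huc : Continuous u := continuous_iff_continuousAt.2 fun x => (hu x).continuousAt
  have hL : ∀ {w : ℝ → ℂ}, Continuous w →
      MemLp w 2 (volume.restrict (Set.Ioc 0 (2 * Real.pi))) := by
    intro w hw
    rw [memLp_two_iff_integrable_sq_norm hw.aestronglyMeasurable]
    exact (hw.norm.pow 2).integrableOn_Ioc
  have hw : Continuous fun x => u' x - Complex.I * a * u x :=
    hu'.sub (continuous_const.mul huc)
  have h1 := (hasSum_sq_fourierCoeffOn Real.two_pi_pos (hL huc)).mul_left D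
  have h2 := hasSum_sq_fourierCoeffOn Real.two_pi_pos (hL hw)
  have h3 := hasSum_le (fun m => ?_) h1 h2
  · simp only [smul_eq_mul, sub_zero] at h3
    rw [← mul_assoc, mul_comm D, mul_assoc] at h3
    exact le_of_mul_le_mul_left h3 (inv_pos.2 Real.two_pi_pos)
  · rw [fourierCoeffOn_sub_mul_self hu hu' hper, norm_mul, mul_pow]
    refine mul_le_mul_of_nonneg_right ?_ (sq_nonneg _)
    have : ‖Complex.I * ((m : ℂ) - a)‖ ^ 2 = ((m : ℝ) - a) ^ 2 := by
      rw [norm_mul, Complex.norm_I, one_mul]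
      have : (m : ℂ) - a = (((m : ℝ) - a : ℝ) : ℂ) := by push_cast; rfl
      rw [this, Complex.norm_real, Real.norm_eq_abs, sq_abs]
    rw [this]
    exact hD m

theorem setLIntegral_enorm_sq_eq_ofReal {w : ℝ → ℂ} (hw : Continuous w) :
    ∫⁻ x in Set.Ico 0 (2 * Real.pi), ‖w x‖ₑ ^ 2 =
      ENNReal.ofReal (∫ x in (0 : ℝ)..(2 * Real.pi), ‖w x‖ ^ 2) := by
  have hi : IntegrableOn (fun x => ‖w x‖ ^ 2) (Set.Ioc 0 (2 * Real.pi)) :=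
    (hw.norm.pow 2).integrableOn_Ioc
  rw [intervalIntegral.integral_of_le Real.two_pi_pos.le, restrict_Ico_eq_restrict_Ioc,
    ofReal_integral_eq_lintegral_ofReal hi
      (Filter.Eventually.of_forall fun x => sq_nonneg _)]
  refine lintegral_congr fun x => ?_
  rw [ENNReal.ofReal_pow (norm_nonneg _), ofReal_norm]

theorem ofReal_mul_setLIntegral_enorm_sq_le {u u' : ℝ → ℂ} (hu : ∀ x, HasDerivAt u (u' x) x)
    (hu' : Continuous u') (hper : u (2 * Real.pi) = u 0) {a D : ℝ} (hD0 : 0 ≤ D)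
    (hD : ∀ m : ℤ, D ≤ ((m : ℝ) - a) ^ 2) :
    ENNReal.ofReal D * ∫⁻ x in Set.Ico 0 (2 * Real.pi), ‖u x‖ₑ ^ 2 ≤
      ∫⁻ x in Set.Ico 0 (2 * Real.pi), ‖u' x - Complex.I * a * u x‖ₑ ^ 2 := by
  have huc : Continuous u := continuous_iff_continuousAt.2 fun x => (hu x).continuousAt
  have hw : Continuous fun x => u' x - Complex.I * a * u x :=
    hu'.sub (continuous_const.mul huc)
  rw [setLIntegral_enorm_sq_eq_ofReal huc, setLIntegral_enorm_sq_eq_ofReal hw,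
    ← ENNReal.ofReal_mul hD0]
  exact ENNReal.ofReal_le_ofReal (mul_integral_norm_sq_le hu hu' hper hD)

/-- Integration over the box `[0, 2π)ⁿ`. -/
abbrev boxMeasure (n : ℕ) : Measure (Fin n → ℝ) :=
  Measure.pi fun _ => volume.restrict (Set.Ico 0 (2 * Real.pi))

theorem ofReal_mul_lintegral_boxMeasure_le {n : ℕ} (i : Fin n) {g g' : (Fin n → ℝ) → ℂ}
    (hg : Continuous g) (hg' : Continuous g')
    (hd : ∀ θ y, HasDerivAt (fun y => g (Function.update θ i y)) (g' (Function.update θ i y)) y)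
    (hper : ∀ θ, g (Function.update θ i (2 * Real.pi)) = g (Function.update θ i 0))
    {a D : ℝ} (hD0 : 0 ≤ D) (hD : ∀ m : ℤ, D ≤ ((m : ℝ) - a) ^ 2) :
    ENNReal.ofReal D * ∫⁻ θ, ‖g θ‖ₑ ^ 2 ∂(boxMeasure n) ≤
      ∫⁻ θ, ‖g' θ - Complex.I * a * g θ‖ₑ ^ 2 ∂(boxMeasure n) := by
  have hm : Measurable fun θ => ‖g θ‖ₑ ^ 2 := by
    have := hg.measurable; fun_prop
  have hm' : Measurable fun θ => ‖g' θ - Complex.I * a * g θ‖ₑ ^ 2 := by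
    have := hg.measurable; have := hg'.measurable; fun_prop
  rw [← lintegral_const_mul _ hm]
  -- By Tonelli it suffices to compare the integrals over the `i`-th angle with the other angles
  -- frozen.
  refine lintegral_le_of_lmarginal_le {i} (hm.const_mul _) hm' ?_
  rw [lmarginal_singleton, lmarginal_singleton]
  intro θ
  dsimp only
  have hmi : Measurable fun y => ‖g (Function.update θ i y)‖ₑ ^ 2 :=
    hm.comp (measurable_update θ)
  rw [lintegral_const_mul _ hmi]
  exact ofReal_mul_setLIntegral_enorm_sq_le (hd θ)
    (hg'.comp (continuous_const.update i continuous_id)) (hper θ) hD0 hD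

/-! ### The Gram matrix of the bundle metric -/

section Gram

variable {n : ℕ}

/-- The vector `x` as a column matrix. -/
def colMatrix (x : Base n) : Matrix (Fin n) Unit ℝ := Matrix.of fun i _ => x i

theorem bundleGram_eq_fromBlocks {G : Matrix (Fin n) (Fin n) ℝ} (hG : Gᵀ = G) (x : Base n) :
    bundleGram G x = Matrix.fromBlocks G 0 0
      (Matrix.fromBlocks (G⁻¹ + colMatrix x * (colMatrix x)ᵀ) (-colMatrix x)
        (-(colMatrix x)ᵀ) 1) := by
  have h1 : ∀ i j, G i j = G j i := fun i j => congrFun (congrFun hG j) i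
  have h2 : ∀ i j, G⁻¹ i j = G⁻¹ j i := fun i j => by
    conv_lhs => rw [← hG, ← Matrix.transpose_nonsing_inv]
    rfl
  ext a b
  rcases a with i | i | i <;> rcases b with j | j | j <;>
    simp [bundleGram, bundleMetric, kahlerMetric, omega, complexStr, connForm, projVec, coordVec,
      colMatrix, Matrix.mul_apply, Pi.single_apply]
  · simp [Matrix.vecMul, dotProduct, h1 i j]
  · simp [Matrix.vecMul, dotProduct]
  · simp [Matrix.vecMul, dotProduct]
  · rw [h2 i j, add_comm]

/-- The Schur complement of the `∂/∂t` entry removes the rank-one term `x xᵀ`, leaving `det G * det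
G⁻¹`. The volume form thus depends neither on `s` nor on the potentials. -/
theorem det_bundleGram {G : Matrix (Fin n) (Fin n) ℝ} (hG : G.PosDef) (x : Base n) :
    (bundleGram G x).det = 1 := by
  have hT : Gᵀ = G := by
    rw [← Matrix.conjTranspose_eq_transpose_of_trivial]; exact hG.isHermitian
  have hu : IsUnit G.det := (Matrix.isUnit_iff_isUnit_det _).1 hG.isUnit
  rw [bundleGram_eq_fromBlocks hT, Matrix.det_fromBlocks_zero₁₂, Matrix.det_fromBlocks_one₂₂]
  simp [Matrix.det_nonsing_inv, mul_inv_cancel₀ hu.ne_zero]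

theorem inv_bundleGram {G : Matrix (Fin n) (Fin n) ℝ} (hG : G.PosDef) (x : Base n) :
    (bundleGram G x)⁻¹ = Matrix.fromBlocks G⁻¹ 0 0
      (Matrix.fromBlocks G (G * colMatrix x) ((colMatrix x)ᵀ * G)
        (1 + (colMatrix x)ᵀ * G * colMatrix x)) := by
  have hT : Gᵀ = G := by
    rw [← Matrix.conjTranspose_eq_transpose_of_trivial]; exact hG.isHermitian
  have hu : IsUnit G.det := (Matrix.isUnit_iff_isUnit_det _).1 hG.isUnit
  apply Matrix.inv_eq_right_inv
  rw [bundleGram_eq_fromBlocks hT, Matrix.fromBlocks_multiply, Matrix.fromBlocks_multiply,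
    ← Matrix.fromBlocks_one, ← Matrix.fromBlocks_one]
  congr 1
  · simp [Matrix.mul_nonsing_inv _ hu]
  · simp
  · simp
  · simp only [Matrix.zero_mul, zero_add]
    congr 1
    · rw [Matrix.add_mul, Matrix.nonsing_inv_mul _ hu, Matrix.neg_mul, Matrix.mul_assoc]
      abel
    · rw [Matrix.add_mul, Matrix.nonsing_inv_mul_cancel_left _ _ hu, Matrix.neg_mul,
        Matrix.mul_add, Matrix.mul_one]
      simp only [Matrix.mul_assoc]
      abel
    · simp
    · simp [Matrix.mul_assoc]

/-- Completing the square splits the dual metric at `(p, q, r)` into `G⁻¹` on `p`, `G` on `q + r x`,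
and `r²`. The first and last terms are nonnegative and are discarded. -/
theorem le_dotProduct_inv_bundleGram {G : Matrix (Fin n) (Fin n) ℝ} (hG : G.PosDef) {c : ℝ}
    (hc : ∀ v : Fin n → ℝ, c * ∑ i, v i ^ 2 ≤ v ⬝ᵥ (G *ᵥ v)) (x : Base n)
    (α : CoordIdx n → ℝ) :
    c * ∑ i, (α (.inr (.inl i)) + x i * α (.inr (.inr ()))) ^ 2 ≤
      α ⬝ᵥ ((bundleGram G x)⁻¹ *ᵥ α) := by
  obtain ⟨p, α', rfl⟩ : ∃ p α', α = Sum.elim p α' := ⟨_, _, (Sum.elim_comp_inl_inr α).symm⟩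
  obtain ⟨q, r, rfl⟩ : ∃ q r, α' = Sum.elim q r := ⟨_, _, (Sum.elim_comp_inl_inr α').symm⟩
  have hT : Gᵀ = G := by
    rw [← Matrix.conjTranspose_eq_transpose_of_trivial]; exact hG.isHermitian
  have hp : 0 ≤ p ⬝ᵥ (G⁻¹ *ᵥ p) := by
    simpa using hG.inv.posSemidef.dotProduct_mulVec_nonneg p
  have hX : colMatrix x *ᵥ r = fun i => x i * r () := by
    ext i; simp [colMatrix, Matrix.mulVec, dotProduct]
  have hXT : ∀ w : Fin n → ℝ, r ⬝ᵥ ((colMatrix x)ᵀ *ᵥ w) = (fun i => x i * r ()) ⬝ᵥ w := by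
    intro w
    rw [Matrix.dotProduct_mulVec, Matrix.vecMul_transpose, hX]
  have key : (Sum.elim p (Sum.elim q r)) ⬝ᵥ ((bundleGram G x)⁻¹ *ᵥ (Sum.elim p (Sum.elim q r))) =
      p ⬝ᵥ (G⁻¹ *ᵥ p) + (q + fun i => x i * r ()) ⬝ᵥ (G *ᵥ (q + fun i => x i * r ())) +
        r () ^ 2 := by
    rw [inv_bundleGram hG, Matrix.fromBlocks_mulVec, Matrix.fromBlocks_mulVec]
    simp only [Sum.elim_comp_inl, Sum.elim_comp_inr, Matrix.zero_mulVec, add_zero, zero_add,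
      sumElim_dotProduct_sumElim, Matrix.add_mulVec, ← Matrix.mulVec_mulVec, hX, hXT,
      Matrix.one_mulVec, Matrix.mulVec_add, dotProduct_add, add_dotProduct]
    have : r ⬝ᵥ r = r () ^ 2 := by simp [dotProduct, sq]
    rw [this]
    ring
  rw [key]
  have := hc (q + fun i => x i * r ())
  simp only [Pi.add_apply] at this
  simp only [Sum.elim_inr, Sum.elim_inl]
  nlinarith [sq_nonneg (r ())]

theorem le_re_sum_inv_bundleGram {G : Matrix (Fin n) (Fin n) ℝ} (hG : G.PosDef) {c : ℝ}
    (hc : ∀ v : Fin n → ℝ, c * ∑ i, v i ^ 2 ≤ v ⬝ᵥ (G *ᵥ v)) (x : Base n)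
    (ξ : CoordIdx n → ℂ) :
    c * ∑ i, ‖ξ (.inr (.inl i)) + x i * ξ (.inr (.inr ()))‖ ^ 2 ≤
      (∑ a, ∑ b, (((bundleGram G x)⁻¹ a b : ℝ) : ℂ) * (ξ a * conj (ξ b))).re := by
  have h1 := le_dotProduct_inv_bundleGram hG hc x fun a => (ξ a).re
  have h2 := le_dotProduct_inv_bundleGram hG hc x fun a => (ξ a).im
  refine (le_of_eq ?_).trans ((add_le_add h1 h2).trans (le_of_eq ?_))
  · rw [← mul_add, ← Finset.sum_add_distrib]
    congr 1
    refine Finset.sum_congr rfl fun i _ => ?_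
    rw [← Complex.normSq_eq_norm_sq, Complex.normSq_apply]
    simp
    ring
  · simp only [dotProduct, Matrix.mulVec, Finset.mul_sum, ← Finset.sum_add_distrib, Complex.re_sum]
    refine Finset.sum_congr rfl fun a _ => Finset.sum_congr rfl fun b _ => ?_
    rw [Complex.re_ofReal_mul]
    simp
    ring

end Gram

namespace DelzantPolytope

variable {n d : ℕ} (P : DelzantPolytope n d)

/-! ### Elementary geometry of the polytope -/

@[fun_prop]
theorem contDiff_slack (r : Fin d) : ContDiff ℝ ∞ (P.slack r) := by
  unfold slack affineSlack
  fun_prop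

@[fun_prop]
theorem continuous_slack (r : Fin d) : Continuous (P.slack r) := (P.contDiff_slack r).continuous

theorem carrier_eq_iInter : P.carrier = ⋂ r, {x | 0 ≤ P.slack r x} := by
  ext x; simp [carrier, polyhedron, slack]

theorem isClosed_carrier : IsClosed P.carrier := by
  rw [carrier_eq_iInter]
  exact isClosed_iInter fun r => isClosed_le continuous_const (P.continuous_slack r)

theorem isCompact_carrier : IsCompact P.carrier :=
  Metric.isCompact_of_isClosed_isBounded P.isClosed_carrier P.isBounded

theorem slack_sub_slack (r : Fin d) (x y : Base n) :
    P.slack r x - P.slack r y = ∑ i, (P.normal r i : ℝ) * (x i - y i) := by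
  simp only [slack, affineSlack, mul_sub, Finset.sum_sub_distrib]
  ring

theorem convex_carrier : Convex ℝ P.carrier := by
  intro x hx y hy a b ha hb hab r
  have h : affineSlack (P.normal r) (P.offset r) (a • x + b • y) =
      a * affineSlack (P.normal r) (P.offset r) x + b * affineSlack (P.normal r) (P.offset r) y := by
    simp only [affineSlack, PiLp.add_apply, PiLp.smul_apply, smul_eq_mul, mul_add,
      Finset.sum_add_distrib, mul_sub, Finset.mul_sum, mul_left_comm _ a, mul_left_comm _ b]
    linear_combination (P.offset r : ℝ) * hab
  rw [h]
  exact add_nonneg (mul_nonneg ha (hx r)) (mul_nonneg hb (hy r))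

theorem uniqueDiffOn_carrier : UniqueDiffOn ℝ P.carrier :=
  uniqueDiffOn_convex P.convex_carrier P.nonempty_interior

theorem exists_vertex : ∃ v, v ∈ P.carrier.extremePoints ℝ :=
  P.isCompact_carrier.extremePoints_nonempty (P.nonempty_interior.mono interior_subset)

/-- Vertices of the polytope are lattice points. -/
theorem exists_int_eq_of_mem_extremePoints {v : Base n} (hv : v ∈ P.carrier.extremePoints ℝ) :
    ∃ m : Fin n → ℤ, ∀ i, v i = m i := by
  -- The integer vectors pairing integrally with `v` contain the normals active at `v`, and these
  -- span `ℤⁿ`.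
  let N : Submodule ℤ (Fin n → ℤ) :=
    { carrier := {a | ∃ m : ℤ, ∑ i, (a i : ℝ) * v i = m}
      add_mem' := by
        rintro a b ⟨m, hm⟩ ⟨m', hm'⟩
        exact ⟨m + m', by simp [add_mul, Finset.sum_add_distrib, hm, hm']⟩
      zero_mem' := ⟨0, by simp⟩
      smul_mem' := by
        rintro c a ⟨m, hm⟩
        exact ⟨c * m, by simp [mul_assoc, ← Finset.mul_sum, hm]⟩ }
  have hN : N = ⊤ := by
    rw [eq_top_iff, ← P.span_at_vertex v hv, Submodule.span_le]
    rintro _ ⟨⟨r, hr⟩, rfl⟩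
    exact ⟨P.offset r, by simpa [affineSlack, sub_eq_zero] using hr⟩
  have h : ∀ i, ∃ m : ℤ, v i = m := by
    intro i
    have : (Pi.single i 1 : Fin n → ℤ) ∈ N := hN ▸ Submodule.mem_top
    obtain ⟨m, hm⟩ := this
    exact ⟨m, by simpa [Pi.single_apply] using hm⟩
  choose m hm using h
  exact ⟨m, hm⟩

/-- The normals of the polytope separate points. -/
theorem eq_zero_of_normal_dotProduct_eq_zero {w : Fin n → ℝ}
    (hw : ∀ r, ∑ i, (P.normal r i : ℝ) * w i = 0) : w = 0 := by
  obtain ⟨v, hv⟩ := P.exists_vertex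
  let N : Submodule ℤ (Fin n → ℤ) :=
    { carrier := {a | ∑ i, (a i : ℝ) * w i = 0}
      add_mem' := by
        intro a b ha hb
        simp_all [add_mul, Finset.sum_add_distrib]
      zero_mem' := by simp
      smul_mem' := by
        intro c a ha
        simp_all [mul_assoc, ← Finset.mul_sum] }
  have hN : N = ⊤ := by
    rw [eq_top_iff, ← P.span_at_vertex v hv, Submodule.span_le]
    rintro _ ⟨⟨r, hr⟩, rfl⟩
    exact hw r
  ext i
  have : (Pi.single i 1 : Fin n → ℤ) ∈ N := hN ▸ Submodule.mem_top
  have h : ∑ j, ((Pi.single i 1 : Fin n → ℤ) j : ℝ) * w j = 0 := this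
  simpa [Pi.single_apply] using h

/-- A vector killed by the Gram matrix is orthogonal to every normal, hence zero. This makes
`angleLift` a genuine right inverse of `φ ↦ ∑ φ_r ν_r`. -/
theorem isUnit_normalMatrix_mul_transpose :
    IsUnit (P.normalMatrix * P.normalMatrixᵀ) := by
  rw [← Matrix.mulVec_injective_iff_isUnit]
  rw [← Matrix.coe_mulVecLin, ← LinearMap.ker_eq_bot, LinearMap.ker_eq_bot']
  intro w hw
  rw [Matrix.mulVecLin_apply, ← Matrix.mulVec_mulVec] at hw
  have h : (P.normalMatrixᵀ *ᵥ w) ⬝ᵥ (P.normalMatrixᵀ *ᵥ w) = 0 := by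
    rw [Matrix.dotProduct_mulVec, Matrix.vecMul_transpose, hw, zero_dotProduct]
  rw [dotProduct_self_eq_zero] at h
  exact P.eq_zero_of_normal_dotProduct_eq_zero fun r => congrFun h r

theorem sum_normal_mul_angleLift (θ : Fin n → ℝ) (i : Fin n) :
    ∑ r, (P.normal r i : ℝ) * P.angleLift θ r = θ i := by
  have h : P.normalMatrix *ᵥ P.angleLift θ = θ := by
    rw [angleLift, Matrix.mulVec_mulVec, Matrix.mulVec_mulVec, Matrix.mul_nonsing_inv,
      Matrix.one_mulVec]
    exact (Matrix.isUnit_iff_isUnit_det _).1 P.isUnit_normalMatrix_mul_transpose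
  exact congrFun h i

theorem angleLift_add (θ θ' : Fin n → ℝ) :
    P.angleLift (θ + θ') = P.angleLift θ + P.angleLift θ' := by
  simp [angleLift, Matrix.mulVec_add]

@[fun_prop]
theorem contDiff_angleLift : ContDiff ℝ ∞ P.angleLift := by
  have h : P.angleLift = LinearMap.toContinuousLinearMap
      (Matrix.mulVecLin (P.normalMatrixᵀ * (P.normalMatrix * P.normalMatrixᵀ)⁻¹)) := by
    ext1 θ
    rw [angleLift, Matrix.mulVec_mulVec]
    rfl
  rw [h]
  exact ContinuousLinearMap.contDiff _

/-! ### Lattice points are Bohr-Sommerfeld points -/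

/-- The monomial section `u = [x, z, σ] ↦ σ^{-k} ∏_r z_r ^ (N_r)` with `N_r = ᵗν_r m - k λ_r`. -/
def monomial (k : ℕ) (N : Fin d → ℕ) (m : Fin n → ℤ)
    (hN : ∀ r, (N r : ℤ) = ∑ i, P.normal r i * m i - k * P.offset r) : P.CircleBundle → ℂ :=
  Quotient.lift (s := P.bundleSetoid)
    (fun p => conj (p.2 : ℂ) ^ k * ∏ r, p.1.1.2 r ^ N r) (by
      rintro p q ⟨κ, hκ, -, hz, hσ⟩
      -- Invariance under `K`: the part of `N_r` linear in `m` contributes 1 by the equations of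
      -- `K`, and the part `-k λ_r` cancels the character.
      have key : conj ((P.weight κ : Circle) : ℂ) ^ k * ∏ r, (κ r : ℂ) ^ N r = 1 := by
        have h1 : (P.weight κ)⁻¹ ^ k * ∏ r, κ r ^ N r = 1 := by
          have h2 : ∀ r, κ r ^ N r = (∏ i, (κ r ^ P.normal r i) ^ m i) * (κ r ^ P.offset r)⁻¹ ^ k := by
            intro r
            have : ∏ i, (κ r ^ P.normal r i) ^ m i = κ r ^ (∑ i, P.normal r i * m i) := by
              simp only [← zpow_mul]
              induction (Finset.univ : Finset (Fin n)) using Finset.induction with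
              | empty => simp
              | insert a s ha ih => rw [Finset.prod_insert ha, Finset.sum_insert ha, zpow_add, ih]
            rw [this, ← zpow_natCast, hN r, ← zpow_neg, ← zpow_natCast, ← zpow_mul, ← zpow_add]
            congr 1
            ring
          have h3 : ∏ r, ∏ i, (κ r ^ P.normal r i) ^ m i = 1 := by
            rw [Finset.prod_comm]
            refine Finset.prod_eq_one fun i _ => ?_
            rw [Finset.prod_zpow, hκ i, one_zpow]
          simp only [h2, Finset.prod_mul_distrib, h3, one_mul, Finset.prod_pow, weight]
          rw [← mul_pow]
          simp
        have h4 : ((∏ r, κ r ^ N r : Circle) : ℂ) = ∏ r, (κ r : ℂ) ^ N r :=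
          map_prod Circle.coeHom _ _
        rw [← Circle.coe_inv_eq_conj, ← h4, ← Circle.coe_pow, ← Circle.coe_mul, h1,
          Circle.coe_one]
      simp only [hz, hσ, mul_pow, Finset.prod_mul_distrib, Circle.coe_mul, map_mul]
      linear_combination (-(conj (p.2 : ℂ) ^ k * ∏ r, p.1.1.2 r ^ N r)) * key)

theorem monomial_toBundle {k : ℕ} {N : Fin d → ℕ} {m : Fin n → ℤ}
    (hN : ∀ r, (N r : ℤ) = ∑ i, P.normal r i * m i - k * P.offset r)
    (p : P.levelSet × Circle) :
    P.monomial k N m hN (P.toBundle p) = conj (p.2 : ℂ) ^ k * ∏ r, p.1.1.2 r ^ N r := rfl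

/-- As `|w|` is constant, `w̄ w'` is purely imaginary. Writing `N = κ w̄ w` in `N w^(N-1) w'` avoids
dividing by `w`, so the formula also covers `w = 0`. -/
theorem hasDerivAt_pow_of_norm_sq_eq {w : ℝ → ℂ} {w' : ℂ} {τ ρ κ : ℝ} {N : ℕ}
    (hw : HasDerivAt w w' τ) (hρ : ∀ τ, ‖w τ‖ ^ 2 = ρ) (hN : (N : ℝ) = κ * ρ) :
    HasDerivAt (fun τ => w τ ^ N) (Complex.I * (κ * (conj (w τ) * w').im : ℝ) * w τ ^ N) τ := by
  have hc : ∀ τ, conj (w τ) * w τ = ρ := fun τ => by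
    rw [mul_comm, Complex.mul_conj, Complex.normSq_eq_norm_sq, hρ]
  have hre : conj (w τ) * w' = Complex.I * ((conj (w τ) * w').im : ℝ) := by
    have h1 : HasDerivAt (fun τ => conj (w τ) * w τ) (conj w' * w τ + conj (w τ) * w') τ :=
      HasDerivAt.mul (Complex.conjCLE.hasFDerivAt.comp_hasDerivAt τ hw) hw
    have h2 : HasDerivAt (fun τ => conj (w τ) * w τ) 0 τ := by
      simp only [hc]
      exact hasDerivAt_const _ _
    have h3 := congrArg Complex.re (h1.unique h2)
    apply Complex.ext
    · simp at h3 ⊢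
      linarith
    · simp
  rcases N with _ | N
  · have h0 : κ * (conj (w τ) * w').im = 0 := by
      rcases mul_eq_zero.1 (hN.symm.trans Nat.cast_zero) with h | h
      · rw [h, zero_mul]
      · have : w τ = 0 := by simpa [h] using hρ τ
        rw [this]; simp
    rw [h0]
    simpa using hasDerivAt_const τ (1 : ℂ)
  · refine (hw.pow (N + 1)).congr_deriv ?_
    have hN' : ((N + 1 : ℕ) : ℂ) = κ * (conj (w τ) * w τ) := by
      rw [hc]; exact_mod_cast hN
    rw [hN', Nat.add_sub_cancel]
    push_cast
    rw [pow_succ]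
    linear_combination (κ * w τ ^ N * w τ : ℂ) * hre

/-- A point `b ∈ P` with `k b ∈ ℤⁿ` is a Bohr-Sommerfeld point of level `k`. -/
theorem mem_bohrSommerfeld {k : ℕ} {b : Base n} (hb : b ∈ P.carrier) {m : Fin n → ℤ}
    (hm : ∀ i, k * b i = m i) : b ∈ P.bohrSommerfeld k := by
  have hs : ∀ r, ((∑ i, P.normal r i * m i - k * P.offset r : ℤ) : ℝ) = k * P.slack r b := by
    intro r
    simp only [slack, affineSlack, mul_sub, Finset.mul_sum]
    push_cast
    congr 1
    refine Finset.sum_congr rfl fun i _ => ?_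
    rw [← hm]; ring
  have hnn : ∀ r, 0 ≤ ∑ i, P.normal r i * m i - k * P.offset r := fun r => by
    have : (0 : ℝ) ≤ ((∑ i, P.normal r i * m i - k * P.offset r : ℤ) : ℝ) :=
      hs r ▸ mul_nonneg k.cast_nonneg (hb r)
    exact_mod_cast this
  -- The exponents of the monomial section are the nonnegative integers `k ℓ_r(b)`.
  choose N hN using fun r => Int.eq_ofNat_of_zero_le (hnn r)
  have hN' : ∀ r, (N r : ℝ) = k * P.slack r b := fun r => by
    rw [← hs, hN]; simp
  refine ⟨hb, P.monomial k N m fun r => (hN r).symm, ?_, ?_, ?_⟩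
  · rintro u - σ
    induction u using Quotient.inductionOn with
    | h p =>
      change (σ : ℂ) ^ k * P.monomial k N m _ (P.toBundle (p.1, p.2 * σ)) =
        P.monomial k N m _ (P.toBundle p)
      rw [monomial_toBundle, monomial_toBundle]
      have : conj (σ : ℂ) * σ = 1 := by
        rw [mul_comm, Complex.mul_conj]; simp
      have h2 : conj (σ : ℂ) ^ k * (σ : ℂ) ^ k = 1 := by rw [← mul_pow, this, one_pow]
      simp only [Circle.coe_mul, map_mul, mul_pow]
      linear_combination (conj (p.2 : ℂ) ^ k * ∏ r, p.1.1.2 r ^ N r) * h2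
  -- The monomial does not vanish here: a coordinate `z_r` is zero only if `ℓ_r(b) = 0`, and then
  -- its exponent is zero.
  · refine ⟨P.toBundle (⟨(b, fun r => ((√(2 * P.slack r b) : ℝ) : ℂ)), fun r => ?_⟩, 1), rfl, ?_⟩
    · have h : 0 ≤ P.slack r b := hb r
      simp [mul_pow, h]
    · rw [monomial_toBundle]
      simp only [Circle.coe_one, map_one, one_pow, one_mul]
      refine Finset.prod_ne_zero_iff.2 fun r _ => ?_
      rcases Nat.eq_zero_or_pos (N r) with h | h
      · simp [h]
      · refine pow_ne_zero _ ?_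
        have hr : 0 ≤ P.slack r b := hb r
        have : P.slack r b ≠ 0 := by
          rintro h0
          have := hN' r
          rw [h0, mul_zero] at this
          exact h.ne' (by exact_mod_cast this)
        have : 0 < P.slack r b := lt_of_le_of_ne hr this.symm
        exact_mod_cast (Real.sqrt_pos.2 (by positivity)).ne'
  · rintro c ⟨hc, hhor⟩ hcb τ τ'
    have hx : ∀ τ, (c τ).1.1.1 = b := hcb
    have hd := hc.differentiable (by simp)
    have hσ : ∀ τ, HasDerivAt (fun τ => ((c τ).2 : ℂ)) (deriv (fun τ => ((c τ).2 : ℂ)) τ) τ :=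
      fun τ => (hd τ).snd.snd.hasDerivAt
    have hz : ∀ r τ, HasDerivAt (fun τ => (c τ).1.1.2 r) (deriv (fun τ => (c τ).1.1.2 r) τ) τ :=
      fun r τ => (differentiableAt_pi.1 (hd τ).snd.fst r).hasDerivAt
    have hzn : ∀ r τ, ‖(c τ).1.1.2 r‖ ^ 2 = 2 * P.slack r b := fun r τ => by
      have := (c τ).1.2 r
      rwa [hx τ] at this
    -- The factor `σ̄^k` contributes `-i k Im(σ̄ σ')` to the logarithmic derivative and the `z_r`
    -- contribute `i (k/2) ∑ Im(z̄_r z_r')`. Horizontality says exactly that these cancel.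
    have h0 : ∀ τ, HasDerivAt (fun τ => P.monomial k N m (fun r => (hN r).symm)
        (P.toBundle (c τ))) 0 τ := by
      intro τ
      simp only [monomial_toBundle, ← map_pow]
      have h1 := hasDerivAt_pow_of_norm_sq_eq (κ := k) (ρ := 1) (N := k) (hσ τ)
        (fun τ => by rw [Circle.norm_coe, one_pow]) (by simp)
      have h1' := (Complex.conjCLE.hasFDerivAt.comp_hasDerivAt τ h1)
      have h2 := HasDerivAt.fun_finsetProd (u := Finset.univ) fun r (_ : r ∈ Finset.univ) =>
        hasDerivAt_pow_of_norm_sq_eq (κ := k / 2) (N := N r) (hz r τ) (hzn r)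
          (by rw [hN' r]; ring)
      convert! HasDerivAt.mul h1' h2 using 1
      have h3 : ∀ r, (∏ j ∈ Finset.univ.erase r, (c τ).1.1.2 j ^ N j) • (Complex.I *
          ((k / 2 * (conj ((c τ).1.1.2 r) * deriv (fun τ => (c τ).1.1.2 r) τ).im : ℝ) : ℂ) *
            (c τ).1.1.2 r ^ N r) = (Complex.I *
          ((k / 2 * (conj ((c τ).1.1.2 r) * deriv (fun τ => (c τ).1.1.2 r) τ).im : ℝ) : ℂ)) *
            ∏ j, (c τ).1.1.2 j ^ N j := by
        intro r
        rw [← Finset.mul_prod_erase _ _ (Finset.mem_univ r), smul_eq_mul]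
        ring
      simp only [h3]
      rw [← Finset.sum_mul, ← Finset.mul_sum, ← Complex.ofReal_sum, ← Finset.mul_sum]
      have h4 := hhor τ
      rw [sub_eq_zero] at h4
      rw [h4]
      generalize ∑ r, (conj ((c τ).1.1.2 r) * deriv (fun τ => (c τ).1.1.2 r) τ).im = S
      have h5 : ∀ (a : ℝ) (w : ℂ), Complex.conjCLE (Complex.I * (a : ℂ) * w) =
          -(Complex.I * a) * conj w := fun a w => by simp
      change 0 = Complex.conjCLE _ * _ + conj _ * _
      rw [h5]
      push_cast
      ring
    exact is_const_of_deriv_eq_zero (fun τ => (h0 τ).differentiableAt) (fun τ => (h0 τ).deriv) τ τ'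

/-- Every vertex is a lattice point. Nonemptiness matters because `Metric.infDist` to the empty set
is 0, which would break the link with thickenings. -/
theorem bohrSommerfeld_nonempty (k : ℕ) : (P.bohrSommerfeld k).Nonempty := by
  obtain ⟨v, hv⟩ := P.exists_vertex
  obtain ⟨m, hm⟩ := P.exists_int_eq_of_mem_extremePoints hv
  exact ⟨v, P.mem_bohrSommerfeld hv.1 (m := fun i => k * m i) fun i => by rw [hm]; push_cast; rfl⟩

theorem exists_abs_slack_sub_le :
    ∃ M : ℝ, 0 ≤ M ∧ ∀ r x y, |P.slack r x - P.slack r y| ≤ M * ‖x - y‖ := by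
  refine ⟨∑ r, ∑ i, |(P.normal r i : ℝ)|,
    Finset.sum_nonneg fun _ _ => Finset.sum_nonneg fun _ _ => abs_nonneg _, fun r x y => ?_⟩
  have h1 : |P.slack r x - P.slack r y| ≤ (∑ i, |(P.normal r i : ℝ)|) * ‖x - y‖ := by
    rw [slack_sub_slack, Finset.sum_mul]
    refine (Finset.abs_sum_le_sum_abs _ _).trans (Finset.sum_le_sum fun i _ => ?_)
    rw [abs_mul]
    exact mul_le_mul_of_nonneg_left (PiLp.norm_apply_le (x - y) i) (abs_nonneg _)
  refine h1.trans (mul_le_mul_of_nonneg_right ?_ (norm_nonneg _))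
  exact Finset.single_le_sum (f := fun r => ∑ i, |(P.normal r i : ℝ)|)
    (fun _ _ => Finset.sum_nonneg fun _ _ => abs_nonneg _) (Finset.mem_univ r)

/-- A point `y` of `k⁻¹ℤⁿ` inside `P` is itself Bohr-Sommerfeld. If `y` lies outside, some `k
ℓ_r(y)` is a negative integer, hence at most `-1`, which keeps `y` a definite distance from `P`. The
bounded distance from `x` to a fixed vertex then suffices. -/
theorem exists_infDist_le_mul_norm_sub {k : ℕ} (hk : 1 ≤ k) :
    ∃ κ : ℝ, 0 < κ ∧ ∀ x ∈ P.carrier, ∀ y : Base n, ∀ m : Fin n → ℤ, (∀ i, k * y i = m i) →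
      Metric.infDist x (P.bohrSommerfeld k) ≤ κ * ‖x - y‖ := by
  obtain ⟨v, hv⟩ := P.bohrSommerfeld_nonempty k
  obtain ⟨D, hD⟩ := P.isBounded.subset_closedBall v
  obtain ⟨M, hM0, hM⟩ := P.exists_abs_slack_sub_le
  have hD' : ∀ x ∈ P.carrier, dist x v ≤ D := fun x hx => hD hx
  have hD0 : 0 ≤ D := dist_nonneg.trans (hD' v hv.1)
  have hk0 : (0 : ℝ) < k := by exact_mod_cast hk
  refine ⟨1 + k * M * D, by positivity, fun x hx y m hm => ?_⟩
  by_cases hy : y ∈ P.carrier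
  · refine (Metric.infDist_le_dist_of_mem (P.mem_bohrSommerfeld hy hm)).trans ?_
    rw [dist_eq_norm, add_mul, one_mul]
    exact le_add_of_nonneg_right (by positivity)
  · obtain ⟨r, hr⟩ : ∃ r, P.slack r y < 0 := by
      by_contra! h
      exact hy h
    have hint : (k : ℝ) * P.slack r y = ((∑ i, P.normal r i * m i - k * P.offset r : ℤ) : ℝ) := by
      simp only [slack, affineSlack, mul_sub, Finset.mul_sum]
      push_cast
      congr 1
      refine Finset.sum_congr rfl fun i _ => ?_
      rw [← hm]; ring
    have h1 : (k : ℝ) * P.slack r y ≤ -1 := by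
      have : (k : ℝ) * P.slack r y < 0 := mul_neg_of_pos_of_neg hk0 hr
      rw [hint] at this ⊢
      have h2 : (∑ i, P.normal r i * m i - k * P.offset r : ℤ) < 0 := by exact_mod_cast this
      exact_mod_cast Int.le_sub_one_of_lt h2
    have h2 : P.slack r x - P.slack r y ≤ M * ‖x - y‖ := (le_abs_self _).trans (hM r x y)
    have h3 : 0 ≤ P.slack r x := hx r
    have h4 : 1 ≤ k * M * ‖x - y‖ := by nlinarith
    refine (Metric.infDist_le_dist_of_mem hv).trans ((hD' x hx).trans ?_)
    nlinarith [norm_nonneg (x - y)]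

/-- The distance to the Bohr-Sommerfeld set is controlled by the distance to `k⁻¹ ℤⁿ`. -/
theorem exists_infDist_sq_le {k : ℕ} (hk : 1 ≤ k) :
    ∃ κ : ℝ, 0 < κ ∧ ∀ x ∈ P.carrier, Metric.infDist x (P.bohrSommerfeld k) ^ 2 ≤
      κ * ∑ i, ((round (k * x i) : ℝ) - k * x i) ^ 2 := by
  obtain ⟨κ, hκ, h⟩ := P.exists_infDist_le_mul_norm_sub hk
  have hk0 : (1 : ℝ) ≤ k := by exact_mod_cast hk
  refine ⟨κ ^ 2, by positivity, fun x hx => ?_⟩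
  -- The nearest point of `k⁻¹ℤⁿ`, which need not lie in `P`.
  set y : Base n := WithLp.toLp 2 fun i => (round (k * x i) : ℝ) / k with hy
  have h1 := h x hx y (fun i => round (k * x i)) fun i => by
    simp only [hy]
    field_simp
  have h2 : ‖x - y‖ ^ 2 ≤ ∑ i, ((round (k * x i) : ℝ) - k * x i) ^ 2 := by
    rw [EuclideanSpace.norm_sq_eq]
    refine Finset.sum_le_sum fun i _ => ?_
    have : ((round (k * x i) : ℝ) - k * x i) ^ 2 = k ^ 2 * (x i - y i) ^ 2 := by
      simp only [hy]
      field_simp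
      ring
    rw [this, Real.norm_eq_abs, sq_abs]
    exact le_mul_of_one_le_left (sq_nonneg _) (one_le_pow₀ hk0)
  calc _ ≤ (κ * ‖x - y‖) ^ 2 := pow_le_pow_left₀ Metric.infDist_nonneg h1 2
    _ = κ ^ 2 * ‖x - y‖ ^ 2 := by ring
    _ ≤ _ := mul_le_mul_of_nonneg_left h2 (by positivity)

/-! ### Lower bounds for the Hessian of the symplectic potential -/

/-- The positive extension equals a determinant times `∏ ℓ_r` in the interior, so no factor can
vanish there. -/
theorem slack_pos_of_isAdmissible {φ : Base n → ℝ} (hφ : P.IsAdmissible φ) {x : Base n}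
    (hx : x ∈ interior P.carrier) (r : Fin d) : 0 < P.slack r x := by
  obtain ⟨-, -, h, -, hpos, hh⟩ := hφ
  have h1 := (hpos x (interior_subset hx)).ne'
  rw [hh x hx] at h1
  have h2 := Finset.prod_ne_zero_iff.1 (right_ne_zero_of_mul h1) r (Finset.mem_univ r)
  exact lt_of_le_of_ne (interior_subset hx r) h2.symm

theorem continuousOn_hessian {ψ : Base n → ℝ} (hψ : ContDiffOn ℝ ∞ ψ P.carrier) :
    ContinuousOn (hessian P.carrier ψ) P.carrier := by
  have h := hψ.continuousOn_iteratedFDerivWithin (m := 2) (by norm_cast)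
    P.uniqueDiffOn_carrier
  refine continuousOn_pi.2 fun i => continuousOn_pi.2 fun j => ?_
  exact (ContinuousMultilinearMap.apply ℝ (fun _ : Fin 2 => Base n) ℝ
    ![EuclideanSpace.single i 1, EuclideanSpace.single j 1]).continuous.comp_continuousOn h

/-- Take the minimum of the Hessian form over the compact set `P × S^{n-1}` and rescale. -/
theorem exists_le_hessian {ψ : Base n → ℝ} (hψ : P.IsStrictlyConvex ψ) :
    ∃ c : ℝ, 0 < c ∧ ∀ x ∈ P.carrier, ∀ v : Fin n → ℝ,
      c * ∑ i, v i ^ 2 ≤ v ⬝ᵥ (hessian P.carrier ψ x *ᵥ v) := by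
  set Φ : Base n × Base n → ℝ := fun p =>
    p.2.ofLp ⬝ᵥ (hessian P.carrier ψ p.1 *ᵥ p.2.ofLp) with hΦ
  have hcont : ContinuousOn Φ (P.carrier ×ˢ Metric.sphere 0 1) := by
    have h1 : ContinuousOn (fun p : Base n × Base n => hessian P.carrier ψ p.1)
        (P.carrier ×ˢ Metric.sphere 0 1) :=
      (P.continuousOn_hessian hψ.1).comp continuousOn_fst fun p hp => hp.1
    have h2 : ContinuousOn (fun p : Base n × Base n => p.2.ofLp)
        (P.carrier ×ˢ Metric.sphere 0 1) := by fun_prop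
    rw [continuousOn_iff_continuous_domRestrict] at h1 h2 ⊢
    exact Continuous.dotProduct h2 (Continuous.matrix_mulVec h1 h2)
  have hpos : ∀ p ∈ P.carrier ×ˢ Metric.sphere (0 : Base n) 1, 0 < Φ p := by
    rintro ⟨x, v⟩ ⟨hx, hv⟩
    have hv0 : v.ofLp ≠ 0 := by
      intro h0
      have : v = 0 := by ext i; exact congrFun h0 i
      simp [this] at hv
    simpa using (hψ.2 x hx).dotProduct_mulVec_pos hv0
  obtain ⟨c, hc, hle⟩ : ∃ c : ℝ, 0 < c ∧ ∀ p ∈ P.carrier ×ˢ Metric.sphere (0 : Base n) 1, c ≤ Φ p := by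
    rcases (P.carrier ×ˢ Metric.sphere (0 : Base n) 1).eq_empty_or_nonempty with h | h
    -- The unit sphere is empty when `n = 0`; any positive constant then works.
    · exact ⟨1, one_pos, by simp [h]⟩
    · obtain ⟨p, hp, hmin⟩ := (P.isCompact_carrier.prod (isCompact_sphere _ _)).exists_isMinOn h hcont
      exact ⟨Φ p, hpos p hp, fun q hq => hmin hq⟩
  refine ⟨c, hc, fun x hx v => ?_⟩
  set w : Base n := WithLp.toLp 2 v with hw
  have hsum : ∑ i, v i ^ 2 = ‖w‖ ^ 2 := by simp [EuclideanSpace.norm_sq_eq, hw]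
  rcases eq_or_ne w 0 with h0 | h0
  · have : v = 0 := by ext i; exact congrArg (fun w : Base n => w i) h0
    simp [this]
  · have hn : ‖w‖ ≠ 0 := norm_ne_zero_iff.2 h0
    have h1 := hle (x, ‖w‖⁻¹ • w) ⟨hx, by simp [norm_smul, hn]⟩
    have h2 : Φ (x, ‖w‖⁻¹ • w) = (‖w‖⁻¹) ^ 2 * (v ⬝ᵥ (hessian P.carrier ψ x *ᵥ v)) := by
      simp only [hΦ, hw, WithLp.ofLp_smul, Matrix.mulVec_smul, smul_dotProduct, dotProduct_smul,
        smul_eq_mul]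
      ring
    rw [h2, inv_pow, inv_mul_eq_div, le_div_iff₀ (by positivity)] at h1
    rwa [hsum]

/-- Additivity needs `v_P` to be `C²` at `x`, which holds where every `ℓ_r` is positive. -/
theorem potentialHessian_eq {φ ψ : Base n → ℝ} (hφ : P.IsAdmissible φ)
    (hψ : P.IsStrictlyConvex ψ) (s : ℝ) {x : Base n} (hx : x ∈ interior P.carrier) :
    P.potentialHessian φ ψ s x =
      hessian P.carrier (fun y => P.vP y + φ y) x + s⁻¹ • hessian P.carrier ψ x := by
  have hxP := interior_subset hx
  have hv : ContDiffAt ℝ 2 P.vP x := by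
    unfold vP
    refine contDiffAt_const.mul (ContDiffAt.sum fun r _ => ?_)
    have h1 : ContDiffAt ℝ 2 (P.slack r) x := (P.contDiff_slack r).contDiffAt.of_le (by norm_cast)
    exact h1.mul (h1.log (P.slack_pos_of_isAdmissible hφ hx r).ne')
  have h2 : ContDiffWithinAt ℝ 2 (fun y => P.vP y + φ y) P.carrier x :=
    hv.contDiffWithinAt.add ((hφ.1 x hxP).of_le (by norm_cast))
  have h3 : ContDiffWithinAt ℝ 2 ψ P.carrier x := (hψ.1 x hxP).of_le (by norm_cast)
  have h4 : ContDiffWithinAt ℝ 2 (s⁻¹ • ψ) P.carrier x := h3.const_smul s⁻¹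
  have h5 := iteratedFDerivWithin_add_apply (i := 2) h2 h4 P.uniqueDiffOn_carrier hxP
  rw [iteratedFDerivWithin_const_smul_apply (i := 2) h3 P.uniqueDiffOn_carrier hxP] at h5
  ext i j
  exact congrArg (fun A => A ![EuclideanSpace.single i (1 : ℝ), EuclideanSpace.single j 1]) h5

theorem exists_le_potentialHessian {φ ψ : Base n → ℝ} (hφ : P.IsAdmissible φ)
    (hψ : P.IsStrictlyConvex ψ) :
    ∃ c : ℝ, 0 < c ∧ ∀ s : ℝ, 0 < s → ∀ x ∈ interior P.carrier,
      (P.potentialHessian φ ψ s x).PosDef ∧ ∀ v : Fin n → ℝ,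
        c / s * ∑ i, v i ^ 2 ≤ v ⬝ᵥ (P.potentialHessian φ ψ s x *ᵥ v) := by
  obtain ⟨c, hc, h⟩ := P.exists_le_hessian hψ
  refine ⟨c, hc, fun s hs x hx => ?_⟩
  have h1 := hφ.2.1 x hx
  rw [P.potentialHessian_eq hφ hψ s hx]
  refine ⟨h1.add ((hψ.2 x (interior_subset hx)).smul (inv_pos.2 hs)), fun v => ?_⟩
  have h2 : 0 ≤ v ⬝ᵥ (hessian P.carrier (fun y => P.vP y + φ y) x *ᵥ v) := by
    simpa using h1.posSemidef.dotProduct_mulVec_nonneg v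
  have h3 := mul_le_mul_of_nonneg_left (h x (interior_subset hx) v) (inv_pos.2 hs).le
  rw [Matrix.add_mulVec, dotProduct_add, Matrix.smul_mulVec, dotProduct_smul, smul_eq_mul,
    div_eq_inv_mul, mul_assoc]
  linarith

/-! ### Functions on the circle bundle in action-angle coordinates -/

theorem isOpen_coordDomain : IsOpen P.coordDomain :=
  isOpen_interior.preimage continuous_fst

/-- The point of `ℝⁿ × ℂᵈ × ℂ` over the point with action-angle coordinates `q`. -/
def ambientChart (q : Coord n) : Base n × (Fin d → ℂ) × ℂ :=
  (q.1, fun r => ((√(2 * P.slack r q.1) : ℝ) : ℂ) *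
      Complex.exp ((P.angleLift q.2.1 r : ℝ) * Complex.I),
    Complex.exp ((q.2.2 - ∑ r, (P.offset r : ℝ) * P.angleLift q.2.1 r : ℝ) * Complex.I))

theorem ambient_chartLift (q : P.coordDomain) : P.ambient (P.chartLift q) = P.ambientChart q := rfl

theorem contDiffAt_ambientChart {q : Coord n} (hq : ∀ r, 0 < P.slack r q.1) :
    ContDiffAt ℝ ∞ P.ambientChart q := by
  have hs : ∀ r, ContDiffAt ℝ ∞ (fun q : Coord n => P.slack r q.1) q := fun r =>
    ((P.contDiff_slack r).comp contDiff_fst).contDiffAt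
  have ha : ∀ r, ContDiffAt ℝ ∞ (fun q : Coord n => P.angleLift q.2.1 r) q := fun r =>
    ((contDiff_apply ℝ ℝ r).comp
      (P.contDiff_angleLift.comp (contDiff_fst.comp contDiff_snd))).contDiffAt
  have he : ∀ {u : Coord n → ℝ}, ContDiffAt ℝ ∞ u q →
      ContDiffAt ℝ ∞ (fun q => Complex.exp ((u q : ℝ) * Complex.I)) q := fun hu =>
    ((Complex.ofRealCLM.contDiff.contDiffAt.comp q hu).mul contDiffAt_const).cexp
  refine contDiffAt_fst.prodMk (ContDiffAt.prodMk (contDiffAt_pi.2 fun r => ?_) (he ?_))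
  · refine (Complex.ofRealCLM.contDiff.contDiffAt.comp q ?_).mul (he (ha r))
    exact (contDiffAt_const.mul (hs r)).sqrt (mul_pos two_pos (hq r)).ne'
  · exact (contDiffAt_snd.snd').sub (ContDiffAt.sum fun r _ => contDiffAt_const.mul (ha r))

theorem inCoord_apply (f : P.CircleBundle → ℂ) (q : P.coordDomain) :
    P.inCoord f q = f (P.chart q) :=
  Subtype.val_injective.extend_apply _ _ q

theorem contDiffAt_inCoord {f : P.CircleBundle → ℂ} (hf : P.IsSmooth f) {q : Coord n}
    (hq : q ∈ P.coordDomain) (hs : ∀ r, 0 < P.slack r q.1) :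
    ContDiffAt ℝ ∞ (P.inCoord f) q := by
  obtain ⟨F, hF, h⟩ := hf
  refine (hF.contDiffAt.comp q (P.contDiffAt_ambientChart hs)).congr_of_eventuallyEq ?_
  filter_upwards [P.isOpen_coordDomain.mem_nhds hq] with q' hq'
  rw [P.inCoord_apply f ⟨q', hq'⟩, chart, h, ambient_chartLift]
  rfl

theorem prod_circleExp_zpow {ι : Type*} (s : Finset ι) (a : ι → ℝ) (z : ι → ℤ) :
    ∏ r ∈ s, Circle.exp (a r) ^ z r = Circle.exp (∑ r ∈ s, (z r : ℝ) * a r) := by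
  classical
  induction s using Finset.induction with
  | empty => simp
  | insert r s hr ih =>
    rw [Finset.prod_insert hr, Finset.sum_insert hr, ih, Circle.exp_add, Circle.exp_intCast_mul]

/-- The two angle lifts differ by some `a` with `∑ a_r ν_r ∈ 2πℤⁿ`, so `e^{ia}` lies in `K`. The
shift `-∑ λ_r a_r` in the phase of `σ` is exactly the character of `e^{ia}`. -/
theorem chart_update_two_pi {x : Base n} (hx : x ∈ interior P.carrier) (θ : Fin n → ℝ) (t : ℝ)
    (i : Fin n) :
    P.chart ⟨(x, Function.update θ i (2 * Real.pi), t), hx⟩ =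
      P.chart ⟨(x, Function.update θ i 0, t), hx⟩ := by
  set a := P.angleLift (Pi.single i (2 * Real.pi)) with ha
  have hθ : P.angleLift (Function.update θ i (2 * Real.pi)) =
      P.angleLift (Function.update θ i 0) + a := by
    rw [ha, ← angleLift_add]
    congr 1
    ext j
    rcases eq_or_ne j i with rfl | h <;> simp [*]
  symm
  refine Quotient.sound (s := P.bundleSetoid) ?_
  refine ⟨fun r => Circle.exp (a r), ?_, rfl, ?_, ?_⟩
  · intro j
    change ∏ r, Circle.exp (a r) ^ P.normal r j = 1
    rw [prod_circleExp_zpow, sum_normal_mul_angleLift]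
    rcases eq_or_ne j i with rfl | h <;> simp [*]
  · intro r
    simp only [chartLift, hθ, Pi.add_apply, Circle.exp_add, Circle.coe_mul]
    ring
  · simp only [chartLift, hθ, Pi.add_apply, weight, MonoidHom.coe_mk, OneHom.coe_mk]
    rw [prod_circleExp_zpow, ← Circle.exp_add]
    congr 1
    simp only [mul_add, Finset.sum_add_distrib]
    push_cast
    simp only [neg_mul, Finset.sum_neg_distrib]
    ring

/-- The principal action of `e^{iτ}` is translation by `τ` in `t`. -/
theorem inCoord_add_time {k : ℕ} {f : P.CircleBundle → ℂ} (hf : f ∈ P.equivariantSmooth k)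
    {q : Coord n} (hq : q ∈ P.coordDomain) (τ : ℝ) :
    P.inCoord f (q + τ • coordVec (.inr (.inr ()))) =
      Complex.exp (-(k * Complex.I) * τ) * P.inCoord f q := by
  have hq' : q + τ • coordVec (.inr (.inr ())) ∈ P.coordDomain := by
    simpa [coordDomain, coordVec] using hq
  rw [P.inCoord_apply f ⟨_, hq'⟩, P.inCoord_apply f ⟨q, hq⟩]
  have h1 := hf.2 (P.chart ⟨q, hq⟩) (Circle.exp τ)
  have h2 : P.rotate (Circle.exp τ) (P.chart ⟨q, hq⟩) = P.chart ⟨_, hq'⟩ := by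
    change P.toBundle _ = P.toBundle _
    congr 1
    apply Prod.ext
    · apply Subtype.ext
      simp [chartLift, coordVec]
    · simp only [chartLift, coordVec, ← Circle.exp_add]
      congr 1
      simp
      ring
  rw [← h2, ← h1, Circle.coe_exp, ← Complex.exp_nat_mul, ← mul_assoc, ← Complex.exp_add]
  ring_nf
  simp

theorem fderiv_inCoord_time {k : ℕ} {f : P.CircleBundle → ℂ} (hf : f ∈ P.equivariantSmooth k)
    {q : Coord n} (hq : q ∈ P.coordDomain) (hs : ∀ r, 0 < P.slack r q.1) :
    fderiv ℝ (P.inCoord f) q (coordVec (.inr (.inr ()))) =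
      -(k * Complex.I) * P.inCoord f q := by
  have h1 := ((P.contDiffAt_inCoord hf.1 hq hs).differentiableAt
    (by simp)).hasFDerivAt.hasLineDerivAt (coordVec (.inr (.inr ())))
  have h2 : HasLineDerivAt ℝ (P.inCoord f) (-(k * Complex.I) * P.inCoord f q) q
      (coordVec (.inr (.inr ()))) := by
    unfold HasLineDerivAt
    simp only [P.inCoord_add_time hf hq]
    have h3 : HasDerivAt (fun τ : ℝ => -(k * Complex.I) * (τ : ℂ)) (-(k * Complex.I)) 0 := by
      simpa using (Complex.ofRealCLM.hasDerivAt (x := (0 : ℝ))).const_mul (-(k * Complex.I))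
    simpa using (h3.cexp).mul_const (P.inCoord f q)
  exact h1.unique h2

theorem hasDerivAt_inCoord_update {f : P.CircleBundle → ℂ} (hf : P.IsSmooth f)
    {x : Base n} (hx : x ∈ interior P.carrier) (hs : ∀ r, 0 < P.slack r x) (i : Fin n) (t : ℝ)
    (θ : Fin n → ℝ) (y : ℝ) :
    HasDerivAt (fun y => P.inCoord f (x, Function.update θ i y, t))
      (fderiv ℝ (P.inCoord f) (x, Function.update θ i y, t) (coordVec (.inr (.inl i)))) y := by
  have h1 := ((P.contDiffAt_inCoord (q := (x, Function.update θ i y, t)) hf hx hs).differentiableAt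
    (by simp)).hasFDerivAt
  exact h1.comp_hasDerivAt y
    ((hasDerivAt_const y x).prodMk ((hasDerivAt_update θ i y).prodMk (hasDerivAt_const y t)))

/-- The derivative of `f` along the horizontal lift `∂/∂θ_i + x_i ∂/∂t`. -/
def horizontalDeriv (f : P.CircleBundle → ℂ) (i : Fin n) (q : Coord n) : ℂ :=
  fderiv ℝ (P.inCoord f) q (coordVec (.inr (.inl i))) +
    q.1 i * fderiv ℝ (P.inCoord f) q (coordVec (.inr (.inr ())))

theorem continuousOn_inCoord {f : P.CircleBundle → ℂ} (hf : P.IsSmooth f)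
    (hs : ∀ x ∈ interior P.carrier, ∀ r, 0 < P.slack r x) :
    ContinuousOn (P.inCoord f) P.coordDomain := fun q hq =>
  (P.contDiffAt_inCoord hf hq (hs q.1 hq)).continuousAt.continuousWithinAt

theorem continuousOn_fderiv_inCoord {f : P.CircleBundle → ℂ} (hf : P.IsSmooth f)
    (hs : ∀ x ∈ interior P.carrier, ∀ r, 0 < P.slack r x) (v : Coord n) :
    ContinuousOn (fun q => fderiv ℝ (P.inCoord f) q v) P.coordDomain := fun q hq =>
  (((P.contDiffAt_inCoord hf hq (hs q.1 hq)).fderiv_right (m := 0)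
    (by norm_cast)).continuousAt.clm_apply continuousAt_const).continuousWithinAt

theorem continuousOn_horizontalDeriv {f : P.CircleBundle → ℂ} (hf : P.IsSmooth f)
    (hs : ∀ x ∈ interior P.carrier, ∀ r, 0 < P.slack r x) (i : Fin n) :
    ContinuousOn (P.horizontalDeriv f i) P.coordDomain := by
  refine (P.continuousOn_fderiv_inCoord hf hs _).add
    (ContinuousOn.mul ?_ (P.continuousOn_fderiv_inCoord hf hs _))
  fun_prop

/-- Integration over the angles `(θ, t)`. -/
abbrev angleMeasure (n : ℕ) : Measure ((Fin n → ℝ) × ℝ) :=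
  (boxMeasure n).prod (volume.restrict (Set.Ico 0 (2 * Real.pi)))

/-- The spectral gap of the horizontal Laplacian on the torus fibre over `x`. -/
theorem ofReal_mul_lintegral_fibre_le {k : ℕ} {f : P.CircleBundle → ℂ}
    (hf : f ∈ P.equivariantSmooth k) (hs : ∀ x ∈ interior P.carrier, ∀ r, 0 < P.slack r x)
    {x : Base n} (hx : x ∈ interior P.carrier) :
    ENNReal.ofReal (∑ i, ((round (k * x i) : ℝ) - k * x i) ^ 2) *
        ∫⁻ p, ‖P.inCoord f (x, p)‖ₑ ^ 2 ∂(angleMeasure n) ≤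
      ∫⁻ p, ∑ i, ‖P.horizontalDeriv f i (x, p)‖ₑ ^ 2 ∂(angleMeasure n) := by
  have hpair : Continuous fun p : (Fin n → ℝ) × ℝ => ((x, p) : Coord n) := by fun_prop
  have hc : Continuous fun p => P.inCoord f (x, p) :=
    (P.continuousOn_inCoord hf.1 hs).comp_continuous hpair fun _ => hx
  have hh : ∀ i, Continuous fun p => P.horizontalDeriv f i (x, p) := fun i =>
    (P.continuousOn_horizontalDeriv hf.1 hs i).comp_continuous hpair fun _ => hx
  have hd : ∀ i, Continuous fun p : (Fin n → ℝ) × ℝ =>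
      fderiv ℝ (P.inCoord f) (x, p) (coordVec (.inr (.inl i))) := fun i =>
    (P.continuousOn_fderiv_inCoord hf.1 hs _).comp_continuous hpair fun _ => hx
  have hm : ∀ {g : (Fin n → ℝ) × ℝ → ℂ}, Continuous g → Measurable fun p => ‖g p‖ₑ ^ 2 :=
    fun hg => hg.measurable.enorm.pow_const 2
  rw [lintegral_finsetSum _ fun i _ => hm (hh i),
    ENNReal.ofReal_sum_of_nonneg fun i _ => sq_nonneg _, Finset.sum_mul]
  refine Finset.sum_le_sum fun i _ => ?_
  rw [lintegral_prod_symm _ (hm hc).aemeasurable, lintegral_prod_symm _ (hm (hh i)).aemeasurable,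
    ← lintegral_const_mul _ (hm hc).lintegral_prod_left']
  refine lintegral_mono fun t => ?_
  have hθ : Continuous fun θ : Fin n → ℝ => (θ, t) := by fun_prop
  have h := ofReal_mul_lintegral_boxMeasure_le i (hc.comp hθ) ((hd i).comp hθ)
    (P.hasDerivAt_inCoord_update hf.1 hx (hs x hx) i t)
    (fun θ => by
      change P.inCoord f (x, _, t) = P.inCoord f (x, _, t)
      rw [P.inCoord_apply f ⟨(x, Function.update θ i (2 * Real.pi), t), hx⟩,
        P.inCoord_apply f ⟨(x, Function.update θ i 0, t), hx⟩, chart_update_two_pi])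
    -- The spectral gap is attained at the integer nearest to `k x_i`.
    (a := k * x i) (sq_nonneg ((round (k * x i) : ℝ) - k * x i)) fun m => by
      rw [sq_le_sq, abs_sub_comm, abs_sub_comm (m : ℝ)]
      exact round_le _ _
  refine h.trans_eq (lintegral_congr fun θ => ?_)
  simp only [Function.comp, horizontalDeriv]
  -- Equivariance turns `∂_{θ_i} + x_i ∂_t` into `∂_{θ_i} - i k x_i`.
  rw [P.fderiv_inCoord_time hf (q := (x, θ, t)) hx (hs x hx)]
  congr 2
  push_cast
  ring

/-! ### Mass and energy in action-angle coordinates -/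

theorem continuous_toBundle : Continuous P.toBundle := continuous_quotient_mk'

theorem isQuotientMap_toBundle : Topology.IsQuotientMap P.toBundle := isQuotientMap_quotient_mk'

theorem continuous_ambient : Continuous P.ambient := by
  unfold ambient
  fun_prop

theorem continuous_moment_proj : Continuous fun u => P.moment (P.proj u) := by
  rw [P.isQuotientMap_toBundle.continuous_iff]
  change Continuous fun p : P.levelSet × Circle => p.1.1.1
  fun_prop

theorem IsSmooth.continuous {P : DelzantPolytope n d} {f : P.CircleBundle → ℂ}
    (hf : P.IsSmooth f) : Continuous f := by
  obtain ⟨F, hF, h⟩ := hf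
  rw [P.isQuotientMap_toBundle.continuous_iff]
  exact (hF.continuous.comp P.continuous_ambient).congr fun p => (h p).symm

theorem continuous_chart : Continuous P.chart := by
  refine P.continuous_toBundle.comp ?_
  have h1 : ∀ r, Continuous fun q : P.coordDomain => P.angleLift q.1.2.1 r := fun r =>
    (continuous_apply r).comp (P.contDiff_angleLift.continuous.comp (by fun_prop))
  have h2 : ∀ r, Continuous fun q : P.coordDomain => P.slack r q.1.1 := fun r =>
    (P.continuous_slack r).comp (by fun_prop)
  have hcoe : Continuous fun z : Circle => (z : ℂ) := by fun_prop
  unfold chartLift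
  refine Continuous.prodMk (Continuous.subtype_mk (Continuous.prodMk (by fun_prop)
    (continuous_pi fun r => ?_)) _) (Circle.exp.continuous.comp ?_)
  · exact (Complex.continuous_ofReal.comp ((h2 r).const_mul 2).sqrt).mul
      (hcoe.comp (Circle.exp.continuous.comp (h1 r)))
  · exact Continuous.sub (by fun_prop) (continuous_finsetSum _ fun r _ => (h1 r).const_mul _)

theorem fundamentalDomain_eq_prod : P.fundamentalDomain = interior P.carrier ×ˢ
    ((Set.univ.pi fun _ : Fin n => Set.Ico 0 (2 * Real.pi)) ×ˢ Set.Ico 0 (2 * Real.pi)) := by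
  ext q
  simp [fundamentalDomain]

theorem volume_restrict_fundamentalDomain :
    (volume.restrict P.fundamentalDomain : Measure (Coord n)) =
      (volume.restrict (interior P.carrier)).prod (angleMeasure n) := by
  rw [fundamentalDomain_eq_prod, angleMeasure, boxMeasure, ← Measure.restrict_pi_pi, Measure.prod_restrict,
    Measure.prod_restrict]
  rfl

theorem measurableSet_fundamentalDomain : MeasurableSet P.fundamentalDomain := by
  rw [fundamentalDomain_eq_prod]
  exact isOpen_interior.measurableSet.prod
    ((MeasurableSet.univ_pi fun _ => measurableSet_Ico).prod measurableSet_Ico)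

theorem coordVolume_eq {φ ψ : Base n → ℝ} {s : ℝ}
    (hG : ∀ x ∈ interior P.carrier, (P.potentialHessian φ ψ s x).PosDef) :
    P.coordVolume φ ψ s = volume.restrict P.fundamentalDomain := by
  rw [coordVolume]
  conv_rhs => rw [← withDensity_one (μ := volume.restrict P.fundamentalDomain)]
  refine withDensity_congr_ae ?_
  filter_upwards [ae_restrict_mem P.measurableSet_fundamentalDomain] with q hq
  rw [det_bundleGram (hG q.1 hq.1)]
  simp

theorem massOn_preimage_eq {φ ψ : Base n → ℝ} {s : ℝ}
    (hG : ∀ x ∈ interior P.carrier, (P.potentialHessian φ ψ s x).PosDef)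
    {f : P.CircleBundle → ℂ} (hf : P.IsSmooth f) {T : Set (Base n)} (hT : MeasurableSet T) :
    P.massOn φ ψ s f {u | P.moment (P.proj u) ∈ T} = ENNReal.ofReal (s ^ (-(n : ℝ) / 2)) *
      ∫⁻ q, {q : Coord n | q.1 ∈ T}.indicator (fun q => ‖P.inCoord f q‖ₑ ^ 2) q
        ∂((volume.restrict (interior P.carrier)).prod (angleMeasure n)) := by
  have hA : MeasurableSet {u | P.moment (P.proj u) ∈ T} :=
    P.continuous_moment_proj.measurable hT
  have hm : Measurable fun u => ‖f u‖ₑ ^ 2 := hf.continuous.measurable.enorm.pow_const 2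
  rw [massOn, Measure.restrict_smul, lintegral_smul_measure, smul_eq_mul, bundleVolume,
    ← lintegral_indicator hA, lintegral_map (hm.indicator hA) P.continuous_chart.measurable]
  congr 1
  have h1 : ∀ q : P.coordDomain,
      {u | P.moment (P.proj u) ∈ T}.indicator (fun u => ‖f u‖ₑ ^ 2) (P.chart q) =
        {q : Coord n | q.1 ∈ T}.indicator (fun q => ‖P.inCoord f q‖ₑ ^ 2) q := by
    intro q
    by_cases hq : q.1.1 ∈ T
    · rw [Set.indicator_of_mem (by exact hq), Set.indicator_of_mem (by exact hq), inCoord_apply]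
    · rw [Set.indicator_of_notMem (by exact hq), Set.indicator_of_notMem (by exact hq)]
  simp only [h1]
  rw [lintegral_subtype_comap P.isOpen_coordDomain.measurableSet, P.coordVolume_eq hG,
    Measure.restrict_restrict P.isOpen_coordDomain.measurableSet,
    Set.inter_eq_right.2 fun q hq => hq.1, volume_restrict_fundamentalDomain]

/-- The bound is pointwise: the dual metric estimate applied to the differential of `f`, integrated
against Lebesgue measure. -/
theorem le_energy {φ ψ : Base n → ℝ} {s c : ℝ} (hc : 0 ≤ c)
    (hG : ∀ x ∈ interior P.carrier, (P.potentialHessian φ ψ s x).PosDef)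
    (hGc : ∀ x ∈ interior P.carrier, ∀ v : Fin n → ℝ,
      c * ∑ i, v i ^ 2 ≤ v ⬝ᵥ (P.potentialHessian φ ψ s x *ᵥ v)) (f : P.CircleBundle → ℂ) :
    ENNReal.ofReal (s ^ (-(n : ℝ) / 2)) *
      ∫⁻ q, ENNReal.ofReal c * ∑ i, ‖P.horizontalDeriv f i q‖ₑ ^ 2
        ∂((volume.restrict (interior P.carrier)).prod (angleMeasure n)) ≤
      P.energy φ ψ s f := by
  rw [energy, P.coordVolume_eq hG, ← volume_restrict_fundamentalDomain]
  refine mul_le_mul_right ?_ _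
  refine setLIntegral_mono' P.measurableSet_fundamentalDomain fun q hq => ?_
  have h1 : ∑ i, ‖P.horizontalDeriv f i q‖ₑ ^ 2 =
      ENNReal.ofReal (∑ i, ‖P.horizontalDeriv f i q‖ ^ 2) := by
    rw [ENNReal.ofReal_sum_of_nonneg fun i _ => sq_nonneg _]
    refine Finset.sum_congr rfl fun i _ => ?_
    rw [ENNReal.ofReal_pow (norm_nonneg _), ofReal_norm]
  rw [h1, ← ENNReal.ofReal_mul hc]
  exact ENNReal.ofReal_le_ofReal
    (le_re_sum_inv_bundleGram (hG q.1 hq.1) (hGc q.1 hq.1) q.1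
      fun a => fderiv ℝ (P.inCoord f) q (coordVec a))

theorem aemeasurable_sum_horizontalDeriv {f : P.CircleBundle → ℂ} (hf : P.IsSmooth f)
    (hs : ∀ x ∈ interior P.carrier, ∀ r, 0 < P.slack r x) :
    AEMeasurable (fun q => ∑ i, ‖P.horizontalDeriv f i q‖ₑ ^ 2)
      ((volume.restrict (interior P.carrier)).prod (angleMeasure n)) := by
  rw [← volume_restrict_fundamentalDomain]
  refine Finset.aemeasurable_fun_sum _ fun i _ => ?_
  have h := ((P.continuousOn_horizontalDeriv hf hs i).mono
    (s := P.coordDomain) (t := P.fundamentalDomain) fun q hq => hq.1).aemeasurable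
      (μ := volume) P.measurableSet_fundamentalDomain
  exact h.enorm.pow_const 2

/-- Chebyshev: off a set over which `∑_i dist(k x_i, ℤ)²` is small, the energy bounds the mass. -/
theorem massOn_mul_le_energy {k : ℕ} {φ ψ : Base n → ℝ} {s c K : ℝ} (hc : 0 ≤ c)
    (hG : ∀ x ∈ interior P.carrier, (P.potentialHessian φ ψ s x).PosDef)
    (hGc : ∀ x ∈ interior P.carrier, ∀ v : Fin n → ℝ,
      c * ∑ i, v i ^ 2 ≤ v ⬝ᵥ (P.potentialHessian φ ψ s x *ᵥ v))
    (hs : ∀ x ∈ interior P.carrier, ∀ r, 0 < P.slack r x)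
    {f : P.CircleBundle → ℂ} (hf : f ∈ P.equivariantSmooth k) {T : Set (Base n)}
    (hT : MeasurableSet T) (hK : ∀ x ∈ interior P.carrier, x ∈ T →
      K ≤ c * ∑ i, ((round (k * x i) : ℝ) - k * x i) ^ 2) :
    ENNReal.ofReal K * P.massOn φ ψ s f {u | P.moment (P.proj u) ∈ T} ≤ P.energy φ ψ s f := by
  refine le_trans ?_ (P.le_energy hc hG hGc f)
  rw [P.massOn_preimage_eq hG hf.1 hT, mul_left_comm]
  refine mul_le_mul_right ?_ _
  calc _ ≤ ENNReal.ofReal K * ∫⁻ x in interior P.carrier, ∫⁻ p,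
        {q : Coord n | q.1 ∈ T}.indicator (fun q => ‖P.inCoord f q‖ₑ ^ 2) (x, p)
          ∂(angleMeasure n) := by
        -- This direction of Tonelli needs no measurability of the integrand.
        exact mul_le_mul_right (lintegral_prod_le _) _
    _ = ∫⁻ x in interior P.carrier, ENNReal.ofReal K * ∫⁻ p,
        {q : Coord n | q.1 ∈ T}.indicator (fun q => ‖P.inCoord f q‖ₑ ^ 2) (x, p)
          ∂(angleMeasure n) := (lintegral_const_mul' _ _ ENNReal.ofReal_ne_top).symm
    _ ≤ ∫⁻ x in interior P.carrier, ∫⁻ p, ENNReal.ofReal c *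
        ∑ i, ‖P.horizontalDeriv f i (x, p)‖ₑ ^ 2 ∂(angleMeasure n) := by
        refine setLIntegral_mono' isOpen_interior.measurableSet fun x hx => ?_
        by_cases hxT : x ∈ T
        · rw [lintegral_const_mul' _ _ ENNReal.ofReal_ne_top]
          have h1 : ∀ p, {q : Coord n | q.1 ∈ T}.indicator (fun q => ‖P.inCoord f q‖ₑ ^ 2) (x, p) =
              ‖P.inCoord f (x, p)‖ₑ ^ 2 := fun p => Set.indicator_of_mem (by exact hxT) _
          simp only [h1]
          refine le_trans ?_ (mul_le_mul_right (P.ofReal_mul_lintegral_fibre_le hf hs hx) _)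
          rw [← mul_assoc, ← ENNReal.ofReal_mul hc]
          gcongr
          exact hK x hx hxT
        · simp [hxT]
    _ = _ := (lintegral_prod _ ((P.aemeasurable_sum_horizontalDeriv hf.1 hs).const_mul _)).symm

end DelzantPolytope

end Toric

end

/-! ### Concentration near the Bohr-Sommerfeld points -/

theorem mainTheorem10 {n d : ℕ} (P : Toric.DelzantPolytope n d)
    (φ ψ : Toric.Base n → ℝ) (hφ : P.IsAdmissible φ) (hψ : P.IsStrictlyConvex ψ)
    (k : ℕ) (hk : 1 ≤ k) (δ : ℝ) (hδ : 0 < δ)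
    (f : ℝ → P.CircleBundle → ℂ)
    (hf : ∀ s ∈ Set.Ioo 0 δ, f s ∈ P.equivariantSmooth k)
    (hnorm : ∀ s ∈ Set.Ioo 0 δ, P.massOn φ ψ s (f s) Set.univ = 1)
    (henergy : ∃ Λ : ℝ≥0, ∀ s ∈ Set.Ioo 0 δ, P.energy φ ψ s (f s) ≤ Λ) :
    ∀ ε : ℝ, 0 < ε → ∃ C : ℝ, 0 < C ∧ ∀ s ∈ Set.Ioo 0 δ,
      ENNReal.ofReal (1 - ε) ≤
        P.massOn φ ψ s (f s)
          {u | P.moment (P.proj u) ∈ P.bsNeighbourhood k (√s * C)} := by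
  intro ε hε
  obtain ⟨Λ, hΛ⟩ := henergy
  obtain ⟨c, hc, hG⟩ := P.exists_le_potentialHessian hφ hψ
  obtain ⟨κ, hκ, hdist⟩ := P.exists_infDist_sq_le hk
  -- Chosen so that `c C² / κ = (Λ + 1) / ε`. The `+ 1` keeps `C` positive when `Λ = 0` and yields
  -- the strict contradiction `Λ + 1 ≤ Λ` below.
  set C : ℝ := √((Λ + 1) * κ / (c * ε)) with hC
  have hCpos : 0 < (Λ + 1) * κ / (c * ε) := by positivity
  refine ⟨C, Real.sqrt_pos.2 hCpos, fun s hs => ?_⟩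
  have hs0 : 0 < s := hs.1
  set T := P.bsNeighbourhood k (√s * C) with hT
  have hTm : MeasurableSet T := P.isClosed_carrier.measurableSet.inter
    Metric.isOpen_thickening.measurableSet
  set A : Set P.CircleBundle := {u | P.moment (P.proj u) ∈ T} with hA
  have hAm : MeasurableSet A := P.continuous_moment_proj.measurable hTm
  have hbound : ENNReal.ofReal ((Λ + 1) / ε) * P.massOn φ ψ s (f s) Aᶜ ≤ Λ := by
    refine le_trans ?_ (hΛ s hs)
    refine P.massOn_mul_le_energy (T := Tᶜ) (div_pos hc hs0).le (fun x hx => (hG s hs0 x hx).1)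
      (fun x hx => (hG s hs0 x hx).2) (fun x hx => P.slack_pos_of_isAdmissible hφ hx)
      (hf s hs) hTm.compl fun x hx hxT => ?_
    have hxP := interior_subset hx
    have h1 : √s * C ≤ Metric.infDist x (P.bohrSommerfeld k) := by
      by_contra! h
      exact hxT ⟨hxP, (Metric.mem_thickening_iff_infDist_lt (P.bohrSommerfeld_nonempty k)).2 h⟩
    have h2 := (pow_le_pow_left₀ (by positivity) h1 2).trans (hdist x hxP)
    rw [mul_pow, Real.sq_sqrt hs0.le, hC, Real.sq_sqrt hCpos.le] at h2
    -- The radius scales as `√s` so that its square cancels the `1 / s` in the Hessian bound.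
    have h3 : (Λ + 1) / ε = c / s * κ⁻¹ * (s * ((Λ + 1) * κ / (c * ε))) := by
      field_simp
    rw [h3, mul_assoc]
    refine mul_le_mul_of_nonneg_left ?_ (div_pos hc hs0).le
    rw [inv_mul_le_iff₀ hκ]
    exact h2
  have hsum : P.massOn φ ψ s (f s) A + P.massOn φ ψ s (f s) Aᶜ = 1 := by
    rw [← hnorm s hs, Toric.DelzantPolytope.massOn, Toric.DelzantPolytope.massOn,
      Toric.DelzantPolytope.massOn, Measure.restrict_univ, lintegral_add_compl _ hAm]
  have hsmall : P.massOn φ ψ s (f s) Aᶜ ≤ ENNReal.ofReal ε := by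
    by_contra! h
    have h1 : ENNReal.ofReal ((Λ + 1) / ε) * ENNReal.ofReal ε ≤ Λ :=
      (mul_le_mul_right h.le _).trans hbound
    rw [← ENNReal.ofReal_mul (by positivity), div_mul_cancel₀ _ hε.ne',
      ← ENNReal.ofReal_coe_nnreal, ENNReal.ofReal_le_ofReal_iff Λ.coe_nonneg] at h1
    linarith
  rw [ENNReal.ofReal_sub _ hε.le, ENNReal.ofReal_one, ← hsum]
  exact tsub_le_iff_right.2 (add_le_add_right hsmall _)
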